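/- **Theorem.** Let $n\ge 0$ and let $B_n$ be the group of permutations $\sigma$ of $\{\pm1,\dots,\pm n\}$ with $\sigma(-k)=-\sigma(k)$ for all $k$, with simple generators $s_0,\dots,s_{n-1}$, where $s_0$ exchanges $1$ and $-1$, and $s_i$ ($i\ge1$) exchanges $i$ with $i+1$ and $-i$ with $-(i+1)$. Let $\ell$ be the word length with respect to these generators, and let $\mathrm{Des}(w)=\{i\in\{0,\dots,n-1\}:\ell(s_iw)<\ell(w)\}$. Write $x\le_{\mathsf L}y$ (left weak order) if some reduced word for $y$ has a reduced word for $x$ as a suffix, and write $[x,y]_{\mathsf L}=\{z: x\le_{\mathsf L}z\le_{\mathsf L}y\}$. A set $X\subseteq B_n$ is *ascent-compatible* if for all $u,v\in X$ and all $i\notin\mathrm{Des}(u)$, $j\notin\mathrm{Des}(v)$ with $u^{-1}s_iu=v^{-1}s_jv$, one has $s_iu\in X$ if and only if $s_jv\in X$. Let $H_n^B(0)$ be the $\mathbb C$-algebra generated by $\pi_0,\dots,\pi_{n-1}$ with relations $\pi_i^2=-\pi_i$; $\pi_i\pi_j=\pi_j\pi_i$ for $|i-j|\ge2$; $\pi_i\pi_{i+1}\pi_i=\pi_{i+1}\pi_i\pi_{i+1}$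 for $i\ge1$; and $\pi_0\pi_1\pi_0\pi_1=\pi_1\pi_0\pi_1\pi_0$. For $I\subseteq\{0,\dots,n-1\}$ let $\mathcal S_I^B$ be the one-dimensional $H_n^B(0)$-module on which $\pi_j$ acts as $-1$ if $j\in I$ and as $0$ if $j\notin I$, and let $$F_I^B=\sum_{\substack{0=i_0\le i_1\le\cdots\le i_n\\ j\in I\Rightarrow i_j<i_{j+1}}}x_{i_1}x_{i_2}\cdots x_{i_n}.$$ Let $\mathrm{ch}^B$ be the homomorphism on the Grothendieck group of finite-dimensional (equivalently, finitely generated) $H_n^B(0)$-modules with $\mathrm{ch}^B([\mathcal S_I^B])=F_I^B$ for all $I$, and write $\mathrm{ch}^B(M)=\mathrm{ch}^B([M])$. For $X\subseteq B_n$ put $\mathcal Q(X)=\sum_{x\in X}F^B_{\mathrm{Des}(x^{-1})}$ and $X^{-1}=\{x^{-1}:x\in X\}$, let $\mathbb CX$ be the complex vector space with basis $X$, and for $x\in X$ put $\pi_i(x)=-x$ if $i\in\mathrm{Des}(x)$, $\pi_i(x)=s_ix$ if $i\notin\mathrm{Des}(x)$ and $s_ix\in X$, and $\pi_i(x)=0$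 otherwise. For $I\subseteq\{0,\dots,n-1\}$ let $D_I^B=\{\sigma\in B_n:\mathrm{Des}(\sigma)=I\}$. For $1\le i\le n$ let $L_i^B$ be the set of all $\sigma\in B_n$ with $\sigma^{-1}(1)>\cdots>\sigma^{-1}(i)<\cdots<\sigma^{-1}(n)$, and let $L^B=\bigcup_{i=1}^nL_i^B$. Then: 1. For every $I\subseteq\{0,\dots,n-1\}$ the set $(D_I^B)^{-1}$ is ascent-compatible, and for every $1\le i\le n$ the set $(L_i^B)^{-1}$ is ascent-compatible. 2. For every $1\le i\le n$ there are elements $\tau\le_{\mathsf L}\sigma$ of $B_n$ given by $\tau(j)=i+1-j$ for $1\le j\le i$ and $\tau(k)=k$ for $i<k\le n$, and by $\sigma(j)=-j$ for $1\le j\le i-1$ and $\sigma(k)=k-i-n$ for $i\le k\le n$, and $(L_i^B)^{-1}=[\tau,\sigma]_{\mathsf L}$. 3. The operators $\pi_0,\dots,\pi_{n-1}$ define $H_n^B(0)$-module structures on $\mathbb C(D_I^B)^{-1}$ and on $\mathbb C(L_i^B)^{-1}$, and for these $$\mathrm{ch}^B\big(\mathbb C(D_I^B)^{-1}\big)=\mathcal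 Q(D_I^B),\qquad \mathrm{ch}^B\big(\mathbb C(L_i^B)^{-1}\big)=\mathcal Q(L_i^B),\qquad \mathrm{ch}^B\Big(\bigoplus_{i=1}^n\mathbb C(L_i^B)^{-1}\Big)=\mathcal Q(L^B).$$ -/

import Mathlib

open scoped Pointwise DirectSum

/-! ### Words, length, descents and left weak order of a group with a family of generators -/

section Generators

variable {ι G : Type*} [Group G] (s : ι → G)

/-- The group element represented by a word in the generators. -/
def wordProd (ω : List ι) : G := (ω.map s).prod

/-- `ω` is a reduced word for `w`: a word of minimum length representing `w`. -/
def IsReducedWord (ω : List ι) (w : G) : Prop :=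
  wordProd s ω = w ∧ ∀ ω' : List ι, wordProd s ω' = w → ω.length ≤ ω'.length

/-- The length of `w`: the number of letters in a reduced word for `w`. -/
noncomputable def wordLength (w : G) : ℕ :=
  sInf {k | ∃ ω : List ι, wordProd s ω = w ∧ ω.length = k}

/-- The set of (left) descents of `w`, as a set of indices of generators. -/
def Des (w : G) : Set ι := {i | wordLength s (s i * w) < wordLength s w}

/-- The left descent class of a set `I` of generators. -/
def descentClass (I : Set ι) : Set G := {w | Des s w = I}

/-- The quadruple `(u, v, s i, s j)` is aligned. -/
def Aligned (u v : G) (i j : ι) : Prop :=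
  i ∉ Des s u ∧ j ∉ Des s v ∧ u⁻¹ * s i * u = v⁻¹ * s j * v

/-- Ascent-compatible subsets. -/
def AscentCompatible (X : Set G) : Prop :=
  ∀ u ∈ X, ∀ v ∈ X, ∀ i j : ι, Aligned s u v i j → (s i * u ∈ X ↔ s j * v ∈ X)

/-- The left weak order: some reduced word for `y` has a reduced word for `x` as a suffix. -/
def LeftWeakLE (x y : G) : Prop :=
  ∃ ωx ωy : List ι, IsReducedWord s ωx x ∧ IsReducedWord s ωy y ∧ ωx <:+ ωy

/-- The interval between `x` and `y` in the left weak order. -/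
def leftInterval (x y : G) : Set G := {z | LeftWeakLE s x z ∧ LeftWeakLE s z y}

open Classical in
/-- The operator `π_i` on the complex vector space `ℂX` freely generated by `X`. -/
noncomputable def piOp (X : Set G) (i : ι) : (X →₀ ℂ) →ₗ[ℂ] (X →₀ ℂ) :=
  Finsupp.linearCombination ℂ fun x : X =>
    if i ∈ Des s (x : G) then -Finsupp.single x 1
    else if h : s i * (x : G) ∈ X then Finsupp.single ⟨s i * (x : G), h⟩ 1
    else 0

end Generators

/-! ### The hyperoctahedral group -/

/-- The set `±[n] = {±1, …, ±n}`. -/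
abbrev SignedSet (n : ℕ) : Type := {k : ℤ // k ∈ (Finset.Icc (-(n : ℤ)) n).erase 0}

instance (n : ℕ) : Neg (SignedSet n) :=
  ⟨fun k => ⟨-k.1, by
    have h := k.2
    simp only [Finset.mem_erase, Finset.mem_Icc] at h ⊢
    omega⟩⟩

@[simp] theorem SignedSet.coe_neg {n : ℕ} (k : SignedSet n) : ((-k : SignedSet n) : ℤ) = -(k : ℤ) :=
  rfl

instance (n : ℕ) : InvolutiveNeg (SignedSet n) :=
  ⟨fun k => Subtype.ext (by simp)⟩

/-- The element `j + 1` of `±[n]`; the index `j : Fin n` runs over `0, …, n - 1`. -/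
def pos {n : ℕ} (j : Fin n) : SignedSet n :=
  ⟨(j : ℤ) + 1, by
    have := j.2
    simp only [Finset.mem_erase, Finset.mem_Icc]
    omega⟩

/-- The hyperoctahedral group: permutations `σ` of `±[n]` with `σ (-k) = -σ k`. -/
def hyperoctahedral (n : ℕ) : Subgroup (Equiv.Perm (SignedSet n)) where
  carrier := {σ | ∀ k, σ (-k) = -σ k}
  mul_mem' := fun {σ τ} hσ hτ k => by
    rw [Equiv.Perm.mul_apply, Equiv.Perm.mul_apply, hτ k, hσ]
  one_mem' := fun _ => rfl
  inv_mem' := fun {σ} hσ k => by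
    rw [Equiv.Perm.inv_eq_iff_eq, hσ, ← Equiv.Perm.mul_apply, mul_inv_cancel, Equiv.Perm.one_apply]

/-- The group `B_n`. -/
abbrev BGroup (n : ℕ) : Type := hyperoctahedral n

theorem swap_neg_apply {n : ℕ} (a b k : SignedSet n) :
    Equiv.swap (-a) (-b) (-k) = -Equiv.swap a b k := by
  simp only [Equiv.swap_apply_def, neg_inj]
  split_ifs <;> rfl

/-- The simple generators of `B_n`, indexed by `0, …, n - 1`: `s_0` exchanges `1` and `-1`, and for
`i ≥ 1` the generator `s_i` exchanges `i` with `i + 1` and `-i` with `-(i + 1)`. -/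
def simpleB (n : ℕ) (i : Fin n) : BGroup n :=
  if h : (i : ℕ) = 0 then
    ⟨Equiv.swap (pos i) (-pos i), fun k => by
      have := swap_neg_apply (pos i) (-pos i) k
      rwa [neg_neg, Equiv.swap_comm] at this⟩
  else
    ⟨Equiv.swap (pos ⟨i - 1, by omega⟩) (pos i) * Equiv.swap (-pos ⟨i - 1, by omega⟩) (-pos i),
      fun k => by
        set a : SignedSet n := pos ⟨i - 1, by omega⟩ with ha
        set b : SignedSet n := pos i with hb
        have hva : (a : ℤ) = i := by simp only [ha, pos]; omega
        have hvb : (b : ℤ) = i + 1 := by simp only [hb, pos]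
        have hcomm : Commute (Equiv.swap a b) (Equiv.swap (-a) (-b)) := by
          refine (Equiv.Perm.disjoint_iff_disjoint_support.2 ?_).commute
          have h1 : a ≠ b := fun e => by have := congrArg Subtype.val e; omega
          have h2 : -a ≠ -b := fun e => h1 (neg_inj.1 e)
          rw [Equiv.Perm.support_swap h1, Equiv.Perm.support_swap h2]
          simp only [Finset.disjoint_left, Finset.mem_insert, Finset.mem_singleton]
          rintro x (rfl | rfl) (e | e) <;>
          · have := congrArg Subtype.val e
            simp only [SignedSet.coe_neg] at this
            omega
        rw [hcomm.eq, Equiv.Perm.mul_apply, ← hcomm.eq, Equiv.Perm.mul_apply]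
        have h3 := swap_neg_apply (-a) (-b) k
        rw [neg_neg, neg_neg] at h3
        rw [h3, swap_neg_apply, ← Equiv.Perm.mul_apply]⟩

/-- The class `L_i^B` of all `σ` with `σ⁻¹(1) > ⋯ > σ⁻¹(i) < ⋯ < σ⁻¹(n)`; the index `i : Fin n` here
stands for the position `i + 1`. -/
def leftUnimodalClass (n : ℕ) (i : Fin n) : Set (BGroup n) :=
  {σ | StrictAntiOn (fun j : Fin n => ((σ⁻¹ : BGroup n).1 (pos j) : ℤ)) (Set.Iic i) ∧
    StrictMonoOn (fun j : Fin n => ((σ⁻¹ : BGroup n).1 (pos j) : ℤ)) (Set.Ici i)}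

/-- The set `L^B` of left-unimodal permutations. -/
def leftUnimodal (n : ℕ) : Set (BGroup n) := ⋃ i : Fin n, leftUnimodalClass n i

/-! ### Type-B quasisymmetric functions -/

/-- The type-B fundamental quasisymmetric function `F_I^B` in the variables `x_0, x_1, …`, for
`I ⊆ [0, n - 1]`: the sum of `x_{f 1} ⋯ x_{f n}` over all `0 = f 0 ≤ f 1 ≤ ⋯ ≤ f n` such that
`f j < f (j + 1)` for all `j ∈ I`. The coefficient of a monomial is the number of such sequences
producing it. -/
noncomputable def fundB (n : ℕ) (I : Set (Fin n)) : MvPowerSeries ℕ ℂ := fun m =>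
  (Nat.card {f : Fin (n + 1) → ℕ // f 0 = 0 ∧ Monotone f ∧
    (∀ j ∈ I, f j.castSucc < f j.succ) ∧ ∑ j : Fin n, Finsupp.single (f j.succ) 1 = m} : ℂ)

/-- `𝒬(X)`, the sum of `F^B` at the descent sets of the inverses of the elements of `X`. -/
noncomputable def QB (n : ℕ) (X : Set (BGroup n)) : MvPowerSeries ℕ ℂ :=
  ∑ᶠ x ∈ X, fundB n (Des (simpleB n) x⁻¹)

/-! ### The type-B 0-Hecke algebra and its simple modules -/

/-- The defining relations of the type-B 0-Hecke algebra. -/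
inductive HeckeBRel (n : ℕ) : FreeAlgebra ℂ (Fin n) → FreeAlgebra ℂ (Fin n) → Prop
  | sq (i : Fin n) : HeckeBRel n (FreeAlgebra.ι ℂ i * FreeAlgebra.ι ℂ i) (-FreeAlgebra.ι ℂ i)
  | comm (i j : Fin n) (h : (i : ℕ) + 2 ≤ j) :
      HeckeBRel n (FreeAlgebra.ι ℂ i * FreeAlgebra.ι ℂ j) (FreeAlgebra.ι ℂ j * FreeAlgebra.ι ℂ i)
  | braid (i j : Fin n) (hi : 1 ≤ (i : ℕ)) (h : (j : ℕ) = i + 1) :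
      HeckeBRel n (FreeAlgebra.ι ℂ i * FreeAlgebra.ι ℂ j * FreeAlgebra.ι ℂ i)
        (FreeAlgebra.ι ℂ j * FreeAlgebra.ι ℂ i * FreeAlgebra.ι ℂ j)
  | braid_zero (i j : Fin n) (hi : (i : ℕ) = 0) (hj : (j : ℕ) = 1) :
      HeckeBRel n
        (FreeAlgebra.ι ℂ i * FreeAlgebra.ι ℂ j * FreeAlgebra.ι ℂ i * FreeAlgebra.ι ℂ j)
        (FreeAlgebra.ι ℂ j * FreeAlgebra.ι ℂ i * FreeAlgebra.ι ℂ j * FreeAlgebra.ι ℂ i)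

/-- The type-B 0-Hecke algebra `H_n^B(0)` over `ℂ`. -/
abbrev HeckeB (n : ℕ) : Type := RingQuot (HeckeBRel n)

/-- The generator `π_i` of `H_n^B(0)`. -/
noncomputable def heckePi (n : ℕ) (i : Fin n) : HeckeB n :=
  RingQuot.mkAlgHom ℂ (HeckeBRel n) (FreeAlgebra.ι ℂ i)

open Classical in
/-- The character of `H_n^B(0)` sending `π_j` to `-1` if `j ∈ I` and to `0` otherwise. -/
noncomputable def heckeChar (n : ℕ) (I : Set (Fin n)) : HeckeB n →ₐ[ℂ] ℂ :=
  RingQuot.liftAlgHom ℂ ⟨FreeAlgebra.lift ℂ fun j => if j ∈ I then (-1 : ℂ) else 0, by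
    intro x y h
    induction h with
    | sq i => by_cases hi : i ∈ I <;> simp [hi]
    | comm i j h => simp only [map_mul]; ring
    | braid i j hi h =>
        by_cases hi : i ∈ I <;> by_cases hj : j ∈ I <;> simp [hi, hj]
    | braid_zero i j hi hj => simp only [map_mul]; ring⟩

open Classical in
theorem heckeChar_pi (n : ℕ) (I : Set (Fin n)) (j : Fin n) :
    heckeChar n I (heckePi n j) = if j ∈ I then (-1 : ℂ) else 0 := by
  simp [heckeChar, heckePi, RingQuot.liftAlgHom_mkAlgHom_apply]

/-- The underlying space of the one-dimensional simple module `𝒮_I^B`. -/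
def SimpleMod (n : ℕ) (_ : Set (Fin n)) : Type := ℂ

namespace SimpleMod

variable (n : ℕ) (I : Set (Fin n))

noncomputable instance : AddCommGroup (SimpleMod n I) := inferInstanceAs (AddCommGroup ℂ)

noncomputable instance : Module ℂ (SimpleMod n I) := inferInstanceAs (Module ℂ ℂ)

instance : Module.Finite ℂ (SimpleMod n I) := inferInstanceAs (Module.Finite ℂ ℂ)

/-- `H_n^B(0)` acts on `𝒮_I^B` through the character of `I`. -/
noncomputable instance : Module (HeckeB n) (SimpleMod n I) :=
  Module.compHom ℂ (heckeChar n I).toRingHom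

theorem smul_def (h : HeckeB n) (v : SimpleMod n I) :
    h • v = heckeChar n I h • v := rfl

instance : IsScalarTower ℂ (HeckeB n) (SimpleMod n I) :=
  ⟨fun c h v => by rw [smul_def, smul_def, map_smul, smul_assoc]⟩

end SimpleMod

/-! ### The Grothendieck group and the type-B quasisymmetric characteristic -/

/-- Finite-dimensional `H_n^B(0)`-modules. As `H_n^B(0)` is a finite-dimensional algebra, these are
its finitely generated modules. -/
structure HeckeMod (n : ℕ) where
  /-- the underlying space -/
  carrier : Type
  [addCommGroup : AddCommGroup carrier]
  [moduleC : Module ℂ carrier]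
  [moduleH : Module (HeckeB n) carrier]
  [isScalarTower : IsScalarTower ℂ (HeckeB n) carrier]
  [finite : Module.Finite ℂ carrier]

attribute [instance] HeckeMod.addCommGroup HeckeMod.moduleC HeckeMod.moduleH
  HeckeMod.isScalarTower HeckeMod.finite

/-- The relations `[A] - [B] + [C]`, one for every short exact sequence `0 → A → B → C → 0` of
`H_n^B(0)`-modules. They identify isomorphic modules, so the classes of modules may be taken in
place of isomorphism classes. -/
def grothendieckRelations (n : ℕ) : Set (FreeAbelianGroup (HeckeMod n)) :=
  {r | ∃ (A B C : HeckeMod n) (f : A.carrier →ₗ[HeckeB n] B.carrier)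
      (g : B.carrier →ₗ[HeckeB n] C.carrier),
      Function.Injective f ∧ Function.Exact f g ∧ Function.Surjective g ∧
      r = FreeAbelianGroup.of A - FreeAbelianGroup.of B + FreeAbelianGroup.of C}

/-- The Grothendieck group `𝒢₀(H_n^B(0))`. -/
abbrev GrothendieckB (n : ℕ) : Type 1 :=
  FreeAbelianGroup (HeckeMod n) ⧸ AddSubgroup.closure (grothendieckRelations n)

/-- The class `[M]` in the Grothendieck group. -/
def grothendieckClass (n : ℕ) (M : Type) [AddCommGroup M] [Module ℂ M] [Module (HeckeB n) M]
    [IsScalarTower ℂ (HeckeB n) M] [Module.Finite ℂ M] : GrothendieckB n :=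
  QuotientAddGroup.mk (FreeAbelianGroup.of (HeckeMod.mk M))

/-- The trace of an endomorphism of a short exact sequence of finite-dimensional spaces is
additive. -/
theorem trace_eq_add_of_exact {A B C : Type*} [AddCommGroup A] [Module ℂ A] [Module.Finite ℂ A]
    [AddCommGroup B] [Module ℂ B] [Module.Finite ℂ B]
    [AddCommGroup C] [Module ℂ C] [Module.Finite ℂ C]
    (f : A →ₗ[ℂ] B) (g : B →ₗ[ℂ] C) (hf : Function.Injective f) (hfg : Function.Exact f g)
    (hg : Function.Surjective g) (a : A →ₗ[ℂ] A) (b : B →ₗ[ℂ] B) (c : C →ₗ[ℂ] C)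
    (hab : b ∘ₗ f = f ∘ₗ a) (hbc : g ∘ₗ b = c ∘ₗ g) :
    LinearMap.trace ℂ B b = LinearMap.trace ℂ A a + LinearMap.trace ℂ C c := by
  obtain ⟨g', hg'⟩ := g.exists_rightInverse_of_surjective (LinearMap.range_eq_top.2 hg)
  obtain ⟨f', hf'⟩ := f.exists_leftInverse_of_injective (LinearMap.ker_eq_bot.2 hf)
  -- correct the retraction so that it kills the image of the section
  set r : B →ₗ[ℂ] A := f' ∘ₗ (LinearMap.id - g' ∘ₗ g) with hr
  have hgg' : ∀ z, g (g' z) = z := fun z => LinearMap.congr_fun hg' z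
  have hff' : ∀ z, f' (f z) = z := fun z => LinearMap.congr_fun hf' z
  have hgf : ∀ z, g (f z) = 0 := fun z => (hfg (f z)).2 ⟨z, rfl⟩
  have hrf : r ∘ₗ f = LinearMap.id := by
    ext z
    simp [hr, hgf, hff']
  have hid : f ∘ₗ r + g' ∘ₗ g = LinearMap.id := by
    ext z
    obtain ⟨y, hy⟩ := (hfg (z - g' (g z))).1 (by simp [hgg'])
    have : r z = y := by
      simp only [hr, LinearMap.comp_apply, LinearMap.sub_apply, LinearMap.id_apply]
      rw [← hy, hff']
    simp [this, hy]
  calc LinearMap.trace ℂ B b = LinearMap.trace ℂ B (b ∘ₗ (f ∘ₗ r + g' ∘ₗ g)) := by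
        rw [hid, LinearMap.comp_id]
    _ = LinearMap.trace ℂ B ((b ∘ₗ f) ∘ₗ r) + LinearMap.trace ℂ B ((b ∘ₗ g') ∘ₗ g) := by
        rw [LinearMap.comp_add, map_add]; rfl
    _ = LinearMap.trace ℂ A (r ∘ₗ (b ∘ₗ f)) + LinearMap.trace ℂ C (g ∘ₗ (b ∘ₗ g')) := by
        rw [LinearMap.trace_comp_comm', LinearMap.trace_comp_comm' (f := b ∘ₗ g')]
    _ = LinearMap.trace ℂ A a + LinearMap.trace ℂ C c := by
        rw [hab, ← LinearMap.comp_assoc, hrf, LinearMap.id_comp, ← LinearMap.comp_assoc, hbc,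
          LinearMap.comp_assoc, hg', LinearMap.comp_id]

open Classical in
/-- There is a homomorphism on the Grothendieck group with `[𝒮_I^B] ↦ F_I^B` for all `I`. -/
theorem exists_chB (n : ℕ) : ∃ ch : GrothendieckB n →+ MvPowerSeries ℕ ℂ,
    ∀ I : Set (Fin n), ch (grothendieckClass n (SimpleMod n I)) = fundB n I := by
  let e : Set (Fin n) → HeckeB n := fun I =>
    ((List.finRange n).map fun j => if j ∈ I then -heckePi n j else 1 + heckePi n j).prod
  have he : ∀ I K : Set (Fin n), heckeChar n K (e I) = if I = K then 1 else 0 := by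
    intro I K
    simp only [e, map_list_prod, List.map_map]
    split_ifs with h
    · subst h
      apply List.prod_eq_one
      intro x hx
      obtain ⟨j, -, rfl⟩ := List.mem_map.1 hx
      by_cases hj : j ∈ I <;> simp [hj, heckeChar_pi]
    · obtain ⟨j, hj⟩ : ∃ j, ¬ (j ∈ I ↔ j ∈ K) := by
        by_contra hcon
        push Not at hcon
        exact h (Set.ext hcon)
      apply List.prod_eq_zero
      refine List.mem_map.2 ⟨j, List.mem_finRange j, ?_⟩
      by_cases hI : j ∈ I <;> by_cases hK : j ∈ K <;> simp_all [heckeChar_pi]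
  let φ : HeckeMod n → MvPowerSeries ℕ ℂ := fun M =>
    ∑ I : Set (Fin n), LinearMap.trace ℂ M.carrier (Algebra.lsmul ℂ ℂ M.carrier (e I)) • fundB n I
  let ψ : FreeAbelianGroup (HeckeMod n) →+ MvPowerSeries ℕ ℂ := FreeAbelianGroup.lift φ
  have hψ : AddSubgroup.closure (grothendieckRelations n) ≤ ψ.ker := by
    rw [AddSubgroup.closure_le]
    rintro r ⟨A, B, C, f, g, hf, hfg, hg, rfl⟩
    have key : φ B = φ A + φ C := by
      simp only [φ, ← Finset.sum_add_distrib, ← add_smul]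
      refine Finset.sum_congr rfl fun I _ => ?_
      rw [trace_eq_add_of_exact (f.restrictScalars ℂ) (g.restrictScalars ℂ) hf hfg hg
        (Algebra.lsmul ℂ ℂ A.carrier (e I)) (Algebra.lsmul ℂ ℂ B.carrier (e I))
        (Algebra.lsmul ℂ ℂ C.carrier (e I))]
      · ext z; simp
      · ext z; simp
    simp only [SetLike.mem_coe, AddMonoidHom.mem_ker, map_add, map_sub, ψ,
      FreeAbelianGroup.lift_apply_of, key]
    abel
  refine ⟨QuotientAddGroup.lift _ ψ hψ, fun K => ?_⟩
  have h1 : QuotientAddGroup.lift _ ψ hψ (grothendieckClass n (SimpleMod n K)) =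
      φ (HeckeMod.mk (SimpleMod n K)) := by
    simp [grothendieckClass, ψ]
  have h2 : ∀ I : Set (Fin n), LinearMap.trace ℂ (SimpleMod n K)
      (Algebra.lsmul ℂ ℂ (SimpleMod n K) (e I)) = if I = K then 1 else 0 := by
    intro I
    have : (Algebra.lsmul ℂ ℂ (SimpleMod n K) (e I) : SimpleMod n K →ₗ[ℂ] SimpleMod n K) =
        heckeChar n K (e I) • LinearMap.id := by
      ext
      rfl
    rw [this, map_smul, LinearMap.trace_id, he]
    have : Module.finrank ℂ (SimpleMod n K) = 1 := Module.finrank_self ℂ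
    simp [this]
  rw [h1]
  simp only [φ, h2]
  simp

/-- The type-B quasisymmetric characteristic: the homomorphism on the Grothendieck group with
`[𝒮_I^B] ↦ F_I^B` for all `I`. -/
noncomputable def chHom (n : ℕ) : GrothendieckB n →+ MvPowerSeries ℕ ℂ :=
  Classical.choose (exists_chB n)

theorem chHom_simple (n : ℕ) (I : Set (Fin n)) :
    chHom n (grothendieckClass n (SimpleMod n I)) = fundB n I :=
  Classical.choose_spec (exists_chB n) I

/-- The type-B quasisymmetric characteristic of a finite-dimensional `H_n^B(0)`-module. -/
noncomputable def chB (n : ℕ) (M : Type) [AddCommGroup M] [Module ℂ M] [Module (HeckeB n) M]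
    [IsScalarTower ℂ (HeckeB n) M] [Module.Finite ℂ M] : MvPowerSeries ℕ ℂ :=
  chHom n (grothendieckClass n M)

/-! ### Inversion sets in the hyperoctahedral group -/

section Inversions

variable {n : ℕ}

/-! Everything is governed by inversion sets. The positive roots are pairs `(a, b)` with `a < b`,
taken up to `(a, b) ~ (-b, -a)`. Passing from `w` to `s_i w` at an ascent adds exactly one
inversion, and that root is determined by the reflection `w⁻¹ s_i w` (`IsAsc.invSet_eq`). Hence
length is the number of inversions, and the left weak order is their inclusion (`leftWeakLE_iff`).

Both families of sets have the form `invClass C D`: the inversions inside a fixed set `C` of roots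
are prescribed to be `D`. For inverse descent classes `C` consists of the simple roots
(`inv_descentClass_eq`). An interval `[x, y]` prescribes the inversions of `x` and forbids those
outside `y` (`leftInterval_eq_invClass`), and the inverse unimodal classes are such intervals
(`inv_leftUnimodalClass_eq`). Every `invClass` is ascent-compatible: whether an ascent stays inside
depends only on whether the added root lies in `C`.

For the module structure, rescale the basis vector of `y` by `(-1)^ℓ(y)`. Then `-π_i` becomes the
Demazure operator `y ↦ max (y, s_i y)`, with elements outside the class sent to zero
(`piOp_signedVec`). This truncation is harmless, because an unwanted inversion never disappears. The
Hecke relations thus reduce to relations between Demazure operators, which become statements about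
sorting the one-line notation of `y⁻¹`.

Finally, the characteristic is computed from a filtration of `ℂX` by subsets closed under ascents.
Removing an element `x` of minimum length splits off the simple module of `Des x`
(`chB_weakOrderModule`). -/

theorem SignedSet.bounds (x : SignedSet n) :
    (x : ℤ) ≠ 0 ∧ -(n : ℤ) ≤ x ∧ (x : ℤ) ≤ n := by
  have h := x.2
  simpa only [Finset.mem_erase, Finset.mem_Icc] using h

theorem coe_pos (j : Fin n) : ((pos j : SignedSet n) : ℤ) = j + 1 := rfl

theorem BGroup.map_neg (w : BGroup n) (x : SignedSet n) : w.1 (-x) = -w.1 x := w.2 x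

theorem BGroup.mul_apply (u w : BGroup n) (x : SignedSet n) : (u * w).1 x = u.1 (w.1 x) := rfl

theorem BGroup.inv_apply_self (w : BGroup n) (x : SignedSet n) : (w⁻¹).1 (w.1 x) = x :=
  Equiv.symm_apply_apply w.1 x

theorem BGroup.apply_inv_self (w : BGroup n) (x : SignedSet n) : w.1 ((w⁻¹).1 x) = x :=
  Equiv.apply_symm_apply w.1 x

theorem BGroup.inv_apply_eq (w : BGroup n) {x y : SignedSet n} :
    (w⁻¹).1 x = y ↔ x = w.1 y := by
  constructor
  · rintro rfl
    rw [w.apply_inv_self]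
  · rintro rfl
    rw [w.inv_apply_self]

theorem coe_simpleB_apply (i : Fin n) (x : SignedSet n) :
    (((simpleB n i).1 x : SignedSet n) : ℤ) =
      if (i : ℕ) = 0 then (if (x : ℤ) = 1 ∨ (x : ℤ) = -1 then -(x : ℤ) else x)
      else if (x : ℤ) = i then (x : ℤ) + 1
      else if (x : ℤ) = i + 1 then (x : ℤ) - 1
      else if (x : ℤ) = -i then (x : ℤ) - 1
      else if (x : ℤ) = -(i + 1) then (x : ℤ) + 1
      else x := by
  by_cases h : (i : ℕ) = 0
  · simp only [simpleB, h, dif_pos, if_true, Equiv.swap_apply_def, Subtype.ext_iff,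
      SignedSet.coe_neg, coe_pos]
    split_ifs <;> (try simp only [SignedSet.coe_neg, coe_pos]) <;> omega
  · simp only [simpleB, h, if_false, Equiv.Perm.mul_apply, Equiv.swap_apply_def,
      Subtype.ext_iff, dif_neg, not_false_eq_true, SignedSet.coe_neg, coe_pos]
    split_ifs <;> (try simp only [SignedSet.coe_neg, coe_pos] at *) <;> omega

theorem simpleB_mul_self (i : Fin n) : simpleB n i * simpleB n i = 1 := by
  refine Subtype.ext (Equiv.ext fun x => Subtype.ext ?_)
  change (((simpleB n i).1 ((simpleB n i).1 x) : SignedSet n) : ℤ) = x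
  have hy := coe_simpleB_apply i x
  have hz := coe_simpleB_apply i ((simpleB n i).1 x)
  have hx := x.bounds
  generalize (simpleB n i).1 ((simpleB n i).1 x) = z at hz ⊢
  generalize (simpleB n i).1 x = y at hy hz
  split_ifs at hy <;> split_ifs at hz <;> omega

theorem simpleB_mul_cancel (i : Fin n) (w : BGroup n) : simpleB n i * (simpleB n i * w) = w := by
  rw [← mul_assoc, simpleB_mul_self, one_mul]

theorem simpleB_inv (i : Fin n) : (simpleB n i)⁻¹ = simpleB n i :=
  inv_eq_of_mul_eq_one_left (simpleB_mul_self i)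

theorem simpleB_simpleB_apply (i : Fin n) (x : SignedSet n) :
    (simpleB n i).1 ((simpleB n i).1 x) = x := by
  rw [← BGroup.mul_apply, simpleB_mul_self]
  rfl

/-- The smaller of the two elements exchanged by `s_i` whose larger one is `i + 1`. -/
def lowerB (i : Fin n) : SignedSet n := (simpleB n i).1 (pos i)

theorem simpleB_lowerB (i : Fin n) : (simpleB n i).1 (lowerB i) = pos i :=
  simpleB_simpleB_apply i _

theorem coe_lowerB (i : Fin n) : (lowerB i : ℤ) = if (i : ℕ) = 0 then -1 else (i : ℤ) := by
  rw [lowerB, coe_simpleB_apply, coe_pos]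
  split_ifs <;> omega

theorem lowerB_lt (i : Fin n) : (lowerB i : ℤ) < pos i := by
  rw [coe_lowerB, coe_pos]
  split_ifs <;> omega

/-- A generator preserves the order of every pair that it does not exchange. -/
theorem simpleB_lt_iff (i : Fin n) {x y : SignedSet n} (h : (simpleB n i).1 x ≠ y) :
    (((simpleB n i).1 x : SignedSet n) : ℤ) < (simpleB n i).1 y ↔ (x : ℤ) < y := by
  have hx := x.bounds
  have hy := y.bounds
  rw [Ne, Subtype.ext_iff, coe_simpleB_apply] at h
  rw [coe_simpleB_apply, coe_simpleB_apply]
  split_ifs at h ⊢ <;> omega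

/-- The pairs exchanged by a generator. -/
theorem simpleB_apply_ne (i : Fin n) {x : SignedSet n} (h : (simpleB n i).1 x ≠ x) :
    x = pos i ∨ x = lowerB i ∨ x = -pos i ∨ x = -lowerB i := by
  have hx := x.bounds
  rw [Ne, Subtype.ext_iff, coe_simpleB_apply] at h
  simp only [Subtype.ext_iff, SignedSet.coe_neg, coe_pos, coe_lowerB]
  split_ifs at h ⊢ <;> omega

/-- The positive roots, one pair `(a, b)` with `a < b` out of `(a, b)` and `(-b, -a)`. -/
noncomputable def posRoots (n : ℕ) : Finset (SignedSet n × SignedSet n) :=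
  Finset.univ.filter fun p => -(p.2 : ℤ) ≤ p.1 ∧ (p.1 : ℤ) < p.2

theorem mem_posRoots {p : SignedSet n × SignedSet n} :
    p ∈ posRoots n ↔ -(p.2 : ℤ) ≤ p.1 ∧ (p.1 : ℤ) < p.2 := by
  simp [posRoots]

/-- The inversions of `w`: the positive roots whose order is reversed by `w`. -/
noncomputable def invSet (w : BGroup n) : Finset (SignedSet n × SignedSet n) :=
  (posRoots n).filter fun p => (w.1 p.2 : ℤ) < w.1 p.1

theorem mem_invSet {w : BGroup n} {p : SignedSet n × SignedSet n} :
    p ∈ invSet w ↔ p ∈ posRoots n ∧ (w.1 p.2 : ℤ) < w.1 p.1 := by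
  simp [invSet]

theorem invSet_one : invSet (1 : BGroup n) = ∅ := by
  ext p
  simp only [mem_invSet, mem_posRoots, Finset.notMem_empty, iff_false]
  rintro ⟨⟨-, h⟩, h'⟩
  exact absurd h (not_lt.2 (le_of_lt h'))

/-- Every pair in increasing order is, up to sign, a positive root. -/
theorem exists_posRoot {a b : SignedSet n} (h : (a : ℤ) < b) :
    (a, b) ∈ posRoots n ∨ (-b, -a) ∈ posRoots n := by
  simp only [mem_posRoots, SignedSet.coe_neg]
  omega

/-- Oddness lets either representative of a root test for an inversion, so inclusion of inversion
sets can be applied without normalizing the pair. -/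
theorem lt_of_invSet_subset {x y : BGroup n} (hxy : invSet x ⊆ invSet y) {a b : SignedSet n}
    (h : (a : ℤ) < b) (hx : (x.1 b : ℤ) < x.1 a) : (y.1 b : ℤ) < y.1 a := by
  rcases exists_posRoot h with h | h
  · exact (mem_invSet.1 (hxy (mem_invSet.2 ⟨h, hx⟩))).2
  · have := (mem_invSet.1 (hxy (mem_invSet.2 ⟨h, by
      simp only [BGroup.map_neg, SignedSet.coe_neg]; omega⟩))).2
    simp only [BGroup.map_neg, SignedSet.coe_neg] at this
    omega

/-- `i` is an ascent of `w`, in terms of the one-line notation of `w⁻¹`. -/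
def IsAsc (w : BGroup n) (i : Fin n) : Prop :=
  (((w⁻¹).1 (lowerB i) : SignedSet n) : ℤ) < (w⁻¹).1 (pos i)

theorem inv_simpleB_mul_apply (w : BGroup n) (i : Fin n) (x : SignedSet n) :
    ((simpleB n i * w)⁻¹).1 x = (w⁻¹).1 ((simpleB n i).1 x) := by
  rw [mul_inv_rev, simpleB_inv]
  rfl

theorem isAsc_simpleB_mul (w : BGroup n) (i : Fin n) :
    IsAsc (simpleB n i * w) i ↔ ¬ IsAsc w i := by
  have h : (w⁻¹).1 (pos i) ≠ (w⁻¹).1 (lowerB i) := fun e => by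
    have := (lowerB_lt i).ne
    rw [(w⁻¹).1.injective e] at this
    exact this rfl
  rw [Ne, Subtype.ext_iff] at h
  simp only [IsAsc, inv_simpleB_mul_apply, simpleB_lowerB]
  change _ < (((w⁻¹).1 (lowerB i) : SignedSet n) : ℤ) ↔ _
  omega

/-- Multiplying by an ascent adds exactly one inversion, determined by the reflection
`w⁻¹ s_i w`. -/
theorem IsAsc.invSet_eq {w : BGroup n} {i : Fin n} (h : IsAsc w i) :
    ∃ p ∈ posRoots n, p ∉ invSet w ∧ invSet (simpleB n i * w) = insert p (invSet w) ∧
      ∀ q ∈ posRoots n, (w⁻¹ * simpleB n i * w).1 q.1 = q.2 ↔ q = p := by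
  set c := (w⁻¹).1 (pos i) with hc
  set d := (w⁻¹).1 (lowerB i) with hd
  have hwc : w.1 c = pos i := w.apply_inv_self _
  have hwd : w.1 d = lowerB i := w.apply_inv_self _
  have hlt : (d : ℤ) < c := h
  have hl := lowerB_lt i
  obtain ⟨p, hp, hpe⟩ : ∃ p ∈ posRoots n, p = (d, c) ∨ p = (-c, -d) := by
    rcases exists_posRoot hlt with h | h
    · exact ⟨_, h, Or.inl rfl⟩
    · exact ⟨_, h, Or.inr rfl⟩
  have hsp : (simpleB n i).1 (w.1 p.1) = w.1 p.2 := by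
    rcases hpe with rfl | rfl
    · simp only [hwd, hwc, simpleB_lowerB]
    · simp only [BGroup.map_neg, hwd, hwc]
      rfl
  have hwp : (w.1 p.1 : ℤ) < w.1 p.2 := by
    rcases hpe with rfl | rfl
    · simpa only [hwd, hwc]
    · simp only [BGroup.map_neg, hwd, hwc, SignedSet.coe_neg]
      omega
  have huniq : ∀ q ∈ posRoots n, (simpleB n i).1 (w.1 q.1) = w.1 q.2 ↔ q = p := by
    intro q hq
    refine ⟨fun hsq => ?_, fun e => e ▸ hsp⟩
    rw [mem_posRoots] at hq hp
    have hne : (simpleB n i).1 (w.1 q.1) ≠ w.1 q.1 := by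
      rw [hsq]
      intro e
      have := w.1.injective e
      rw [this] at hq
      exact absurd hq.2 (lt_irrefl _)
    -- The generator moves only the four elements `±pos i`, `±lowerB i`, and `w` pulls these back to
    -- `±c`, `±d`.
    have key : q = (c, d) ∨ q = (d, c) ∨ q = (-c, -d) ∨ q = (-d, -c) := by
      rcases simpleB_apply_ne i hne with e | e | e | e
      · rw [e] at hsq
        refine Or.inl (Prod.ext (w.1.injective (e.trans hwc.symm))
          (w.1.injective (hsq.symm.trans hwd.symm)))
      · rw [e, simpleB_lowerB] at hsq
        refine Or.inr (Or.inl (Prod.ext (w.1.injective (e.trans hwd.symm))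
          (w.1.injective (hsq.symm.trans hwc.symm))))
      · rw [e, BGroup.map_neg] at hsq
        refine Or.inr (Or.inr (Or.inl (Prod.ext (w.1.injective ?_) (w.1.injective ?_))))
        · rw [e, BGroup.map_neg, hwc]
        · rw [← hsq, BGroup.map_neg, hwd]
          rfl
      · rw [e, BGroup.map_neg, simpleB_lowerB] at hsq
        refine Or.inr (Or.inr (Or.inr (Prod.ext (w.1.injective ?_) (w.1.injective ?_))))
        · rw [e, BGroup.map_neg, hwd]
        · rw [← hsq, BGroup.map_neg, hwc]
    -- Of the four ordered pairs only `(d, c)` and `(-c, -d)` are increasing, and the normalization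
    -- in `posRoots` selects one of them.
    rcases key with rfl | rfl | rfl | rfl <;> rcases hpe with rfl | rfl <;>
      simp only [SignedSet.coe_neg, Prod.mk.injEq, Subtype.ext_iff] at hp hq ⊢ <;> omega
  refine ⟨p, hp, fun h' => absurd (mem_invSet.1 h').2 (not_lt.2 hwp.le), ?_, fun q hq => ?_⟩
  · ext q
    rw [Finset.mem_insert, mem_invSet, mem_invSet]
    constructor
    · rintro ⟨hq, hlt⟩
      by_cases e : q = p
      · exact Or.inl e
      · refine Or.inr ⟨hq, ?_⟩
        have h1 := mt (huniq q hq).1 e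
        rwa [BGroup.mul_apply, BGroup.mul_apply, simpleB_lt_iff] at hlt
        intro e'
        exact h1 (by rw [← e', simpleB_simpleB_apply])
    · rintro (rfl | ⟨hq, hlt⟩)
      · refine ⟨hp, ?_⟩
        rw [BGroup.mul_apply, BGroup.mul_apply, hsp, ← hsp, simpleB_simpleB_apply, hsp]
        exact hwp
      · refine ⟨hq, ?_⟩
        rwa [BGroup.mul_apply, BGroup.mul_apply, simpleB_lt_iff]
        intro e'
        have : q = p := (huniq q hq).1 (by rw [← e', simpleB_simpleB_apply])
        rw [this] at hlt
        omega
  · rw [← huniq q hq, BGroup.mul_apply, BGroup.mul_apply, BGroup.inv_apply_eq]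

theorem IsAsc.card_invSet {w : BGroup n} {i : Fin n} (h : IsAsc w i) :
    (invSet (simpleB n i * w)).card = (invSet w).card + 1 := by
  obtain ⟨p, -, hp, e, -⟩ := h.invSet_eq
  rw [e, Finset.card_insert_of_notMem hp]

theorem IsAsc.invSet_subset {w : BGroup n} {i : Fin n} (h : IsAsc w i) :
    invSet w ⊆ invSet (simpleB n i * w) := by
  obtain ⟨p, -, -, e, -⟩ := h.invSet_eq
  rw [e]
  exact Finset.subset_insert _ _

theorem card_invSet_of_not_isAsc {w : BGroup n} {i : Fin n} (h : ¬ IsAsc w i) :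
    (invSet (simpleB n i * w)).card + 1 = (invSet w).card := by
  have := ((isAsc_simpleB_mul w i).2 h).card_invSet
  rw [simpleB_mul_cancel] at this
  exact this.symm

/-- Only the identity has no descents. -/
theorem eq_one_of_forall_isAsc {w : BGroup n} (h : ∀ i, IsAsc w i) : w = 1 := by
  -- Without descents, `0 < w⁻¹(1) < ⋯ < w⁻¹(n) ≤ n`. Counting up from the left end and down from
  -- the right end squeezes each value to its position.
  have hstep : ∀ j : ℕ, ∀ (hj : j + 1 < n),
      (((w⁻¹).1 (pos ⟨j, by omega⟩) : SignedSet n) : ℤ) < (w⁻¹).1 (pos ⟨j + 1, hj⟩) := by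
    intro j hj
    have h1 := h ⟨j + 1, hj⟩
    have : lowerB (⟨j + 1, hj⟩ : Fin n) = pos ⟨j, by omega⟩ := by
      rw [Subtype.ext_iff, coe_lowerB, coe_pos]
      simp
    rwa [IsAsc, this] at h1
  have hlow : ∀ j : ℕ, ∀ (hj : j < n),
      (j : ℤ) + 1 ≤ (((w⁻¹).1 (pos ⟨j, hj⟩) : SignedSet n) : ℤ) := by
    intro j
    induction j with
    | zero =>
      intro hj
      have h1 := h ⟨0, hj⟩
      have : lowerB (⟨0, hj⟩ : Fin n) = -pos ⟨0, hj⟩ := by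
        rw [Subtype.ext_iff, coe_lowerB, SignedSet.coe_neg, coe_pos]
        simp
      rw [IsAsc, this, BGroup.map_neg, SignedSet.coe_neg] at h1
      rw [Nat.cast_zero]
      omega
    | succ j ih =>
      intro hj
      have h1 := hstep j hj
      have h2 := ih (by omega)
      rw [Nat.cast_succ]
      omega
  have hup : ∀ k j : ℕ, ∀ (hj : j < n), j + k + 1 = n →
      (((w⁻¹).1 (pos ⟨j, hj⟩) : SignedSet n) : ℤ) ≤ (j : ℤ) + 1 := by
    intro k
    induction k with
    | zero =>
      intro j hj e
      have := ((w⁻¹).1 (pos ⟨j, hj⟩)).bounds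
      omega
    | succ k ih =>
      intro j hj e
      have h1 := hstep j (by omega)
      have h2 := ih (j + 1) (by omega) (by omega)
      rw [Nat.cast_succ] at h2
      omega
  have hpos : ∀ j : Fin n, (w⁻¹).1 (pos j) = pos j := fun j => by
    have h1 := hlow j j.2
    have h2 := hup (n - 1 - j) j j.2 (by omega)
    rw [Subtype.ext_iff, coe_pos]
    exact le_antisymm h2 h1
  rw [← inv_eq_one]
  refine Subtype.ext (Equiv.ext fun x => ?_)
  have hx := x.bounds
  rcases lt_or_gt_of_ne hx.1 with hneg | hpos'
  · have e : x = -pos ⟨(-(x : ℤ) - 1).toNat, by omega⟩ := by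
      rw [Subtype.ext_iff, SignedSet.coe_neg, coe_pos]
      simp only
      omega
    rw [e, BGroup.map_neg, hpos]
    rfl
  · have e : x = pos ⟨((x : ℤ) - 1).toNat, by omega⟩ := by
      rw [Subtype.ext_iff, coe_pos]
      simp only
      omega
    rw [e, hpos]
    rfl

end Inversions

/-! ### Length, descents and weak order through inversions -/

section Length

variable {n : ℕ}

theorem wordProd_cons {ι G : Type*} [Group G] (s : ι → G) (i : ι) (ω : List ι) :
    wordProd s (i :: ω) = s i * wordProd s ω := by
  simp [wordProd]

theorem wordProd_append {ι G : Type*} [Group G] (s : ι → G) (ω ω' : List ι) :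
    wordProd s (ω ++ ω') = wordProd s ω * wordProd s ω' := by
  simp [wordProd]

/-- Each letter changes the number of inversions by exactly one, up or down. This is the lower bound
for length. -/
theorem card_invSet_wordProd_mul_le (ω : List (Fin n)) (x : BGroup n) :
    (invSet (wordProd (simpleB n) ω * x)).card ≤ ω.length + (invSet x).card := by
  induction ω with
  | nil => simp [wordProd]
  | cons i ω ih =>
    rw [wordProd_cons, mul_assoc, List.length_cons]
    by_cases h : IsAsc (wordProd (simpleB n) ω * x) i
    · rw [h.card_invSet]
      omega
    · have := card_invSet_of_not_isAsc h
      omega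

theorem card_invSet_wordProd_le (ω : List (Fin n)) :
    (invSet (wordProd (simpleB n) ω)).card ≤ ω.length := by
  simpa [invSet_one] using card_invSet_wordProd_mul_le ω 1

/-- If `y` has more inversions than `x`, one of them can be added to `x` by an ascent. -/
theorem exists_isAsc_of_invSet_subset {x y : BGroup n} (h : invSet x ⊆ invSet y) (hxy : x ≠ y) :
    ∃ i, IsAsc x i ∧ invSet (simpleB n i * x) ⊆ invSet y := by
  -- A descent of `x y⁻¹ ≠ 1` is the right choice: `x` sends some pair `d`, `c` to the pair
  -- exchanged by `s_i`, and `y` has `c` below `d`.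
  obtain ⟨i, hi⟩ : ∃ i, ¬ IsAsc (x * y⁻¹) i := by
    by_contra hcon
    push Not at hcon
    exact hxy (mul_inv_eq_one.1 (eq_one_of_forall_isAsc hcon))
  have hmul : ∀ e : SignedSet n, ((x * y⁻¹)⁻¹).1 e = y.1 ((x⁻¹).1 e) := fun e => by
    rw [mul_inv_rev, inv_inv]
    rfl
  rw [IsAsc, hmul, hmul, not_lt] at hi
  set c := (x⁻¹).1 (pos i) with hc
  set d := (x⁻¹).1 (lowerB i) with hd
  have hl := lowerB_lt i
  have hxc : x.1 c = pos i := x.apply_inv_self _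
  have hxd : x.1 d = lowerB i := x.apply_inv_self _
  have hne : d ≠ c := fun e => by
    rw [← hxc, ← hxd, e] at hl
    exact lt_irrefl _ hl
  have hyne : y.1 c ≠ y.1 d := fun e => hne (y.1.injective e).symm
  rw [Ne, Subtype.ext_iff] at hne hyne
  -- If `c < d`, then `x` inverts this pair, hence so does `y`, against the choice of `i`. So `d <
  -- c`, and the inversion gained at `i` is one that `y` already has.
  have hasc : IsAsc x i := by
    change (d : ℤ) < c
    by_contra hcd
    have := lt_of_invSet_subset h (a := c) (b := d) (by omega) (by rw [hxc, hxd]; exact hl)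
    omega
  refine ⟨i, hasc, ?_⟩
  obtain ⟨p, hp, -, e, huniq⟩ := hasc.invSet_eq
  rw [e, Finset.insert_subset_iff]
  refine ⟨mem_invSet.2 ⟨hp, ?_⟩, h⟩
  have hdc : (d : ℤ) < c := hasc
  have ht : (x⁻¹ * simpleB n i * x).1 d = c := by
    rw [BGroup.mul_apply, BGroup.mul_apply, hxd, simpleB_lowerB]
  have ht' : (x⁻¹ * simpleB n i * x).1 c = d := by
    rw [BGroup.mul_apply, BGroup.mul_apply, hxc]
    rfl
  rcases exists_posRoot hdc with hq | hq
  · rw [← (huniq _ hq).1 ht]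
    simp only
    omega
  · rw [← (huniq _ hq).1 (by rw [BGroup.map_neg, ht'])]
    simp only [BGroup.map_neg, SignedSet.coe_neg]
    omega

/-- Inclusion of inversion sets is realized by a word of ascents. -/
theorem exists_word_of_invSet_subset {x y : BGroup n} (h : invSet x ⊆ invSet y) :
    ∃ ω : List (Fin n), wordProd (simpleB n) ω * x = y ∧
      ω.length + (invSet x).card = (invSet y).card := by
  induction hk : (invSet y).card - (invSet x).card generalizing x with
  | zero =>
    by_cases hxy : x = y
    · exact ⟨[], by simp [wordProd, hxy], by simp [hxy]⟩
    · obtain ⟨i, hi, hsub⟩ := exists_isAsc_of_invSet_subset h hxy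
      have h1 := hi.card_invSet
      have h2 := Finset.card_le_card hsub
      omega
  | succ k ih =>
    have hxy : x ≠ y := by
      rintro rfl
      omega
    obtain ⟨i, hi, hsub⟩ := exists_isAsc_of_invSet_subset h hxy
    have h1 := hi.card_invSet
    obtain ⟨ω, hω, hlen⟩ := ih hsub (by omega)
    -- The letter `i` acts on `x` first, so it stands at the right end of the word.
    refine ⟨ω ++ [i], ?_, ?_⟩
    · rw [wordProd_append, wordProd_cons, mul_assoc, mul_assoc, ← hω]
      simp [wordProd]
    · simp only [List.length_append, List.length_singleton]
      omega

theorem exists_word_length_eq (w : BGroup n) :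
    ∃ ω : List (Fin n), wordProd (simpleB n) ω = w ∧ ω.length = (invSet w).card := by
  obtain ⟨ω, h1, h2⟩ := exists_word_of_invSet_subset (x := 1) (y := w) (by simp [invSet_one])
  exact ⟨ω, by simpa using h1, by simpa [invSet_one] using h2⟩

theorem isReducedWord_iff {ω : List (Fin n)} {w : BGroup n} :
    IsReducedWord (simpleB n) ω w ↔
      wordProd (simpleB n) ω = w ∧ ω.length = (invSet w).card := by
  constructor
  · rintro ⟨h, hmin⟩
    obtain ⟨ω', h1, h2⟩ := exists_word_length_eq w
    refine ⟨h, le_antisymm (h2 ▸ hmin ω' h1) ?_⟩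
    rw [← h]
    exact card_invSet_wordProd_le ω
  · rintro ⟨h, hlen⟩
    refine ⟨h, fun ω' h' => ?_⟩
    rw [hlen, ← h']
    exact card_invSet_wordProd_le ω'

theorem wordLength_eq (w : BGroup n) : wordLength (simpleB n) w = (invSet w).card := by
  obtain ⟨ω, h1, h2⟩ := exists_word_length_eq w
  refine le_antisymm (Nat.sInf_le ⟨ω, h1, h2⟩) ?_
  refine le_csInf ⟨_, ω, h1, rfl⟩ ?_
  rintro k ⟨ω', rfl, rfl⟩
  exact card_invSet_wordProd_le ω'

theorem notMem_Des_iff {w : BGroup n} {i : Fin n} : i ∉ Des (simpleB n) w ↔ IsAsc w i := by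
  rw [Des, Set.mem_ofPred_eq, wordLength_eq, wordLength_eq]
  by_cases h : IsAsc w i
  · simp only [h, iff_true, h.card_invSet]
    omega
  · have := card_invSet_of_not_isAsc h
    simp only [h, iff_false]
    omega

theorem mem_Des_iff {w : BGroup n} {i : Fin n} : i ∈ Des (simpleB n) w ↔ ¬ IsAsc w i := by
  rw [← notMem_Des_iff, not_not]

/-- Attaining the maximal count forces every letter to be an ascent, and ascents only add
inversions. -/
theorem invSet_subset_of_card_eq {ω : List (Fin n)} {x : BGroup n}
    (h : (invSet (wordProd (simpleB n) ω * x)).card = ω.length + (invSet x).card) :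
    invSet x ⊆ invSet (wordProd (simpleB n) ω * x) := by
  induction ω with
  | nil => simp [wordProd]
  | cons i ω ih =>
    rw [wordProd_cons, mul_assoc, List.length_cons] at h
    rw [wordProd_cons, mul_assoc]
    have hle := card_invSet_wordProd_mul_le ω x
    by_cases hi : IsAsc (wordProd (simpleB n) ω * x) i
    · rw [hi.card_invSet] at h
      exact (ih (by omega)).trans hi.invSet_subset
    · have := card_invSet_of_not_isAsc hi
      omega

/-- The left weak order is inclusion of inversion sets. -/
theorem leftWeakLE_iff {x y : BGroup n} :
    LeftWeakLE (simpleB n) x y ↔ invSet x ⊆ invSet y := by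
  constructor
  · rintro ⟨ωx, ωy, hx, hy, ω, rfl⟩
    rw [isReducedWord_iff] at hx hy
    obtain ⟨rfl, hx⟩ := hx
    obtain ⟨rfl, hy⟩ := hy
    rw [wordProd_append] at hy ⊢
    refine invSet_subset_of_card_eq ?_
    rw [← hy, ← hx, List.length_append]
  · intro h
    obtain ⟨ωx, rfl, hx⟩ := exists_word_length_eq x
    obtain ⟨ω, rfl, hω⟩ := exists_word_of_invSet_subset h
    refine ⟨ωx, ω ++ ωx, isReducedWord_iff.2 ⟨rfl, hx⟩, isReducedWord_iff.2 ⟨?_, ?_⟩, ω, rfl⟩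
    · rw [wordProd_append]
    · rw [← hω, List.length_append, hx]

end Length

/-! ### Classes of elements with prescribed inversions -/

section InvClass

variable {n : ℕ}

/-- The elements whose inversions in `C` are exactly those in `D`. -/
def invClass (C D : Set (SignedSet n × SignedSet n)) : Set (BGroup n) :=
  {w | (invSet w : Set (SignedSet n × SignedSet n)) ∩ C = D}

theorem mem_invClass {C D : Set (SignedSet n × SignedSet n)} {w : BGroup n} :
    w ∈ invClass C D ↔ (invSet w : Set (SignedSet n × SignedSet n)) ∩ C = D := Iff.rfl

/-- Equal reflections `u⁻¹ s_i u = v⁻¹ s_j v` add the same root `p` to `u` and to `v`. As `p` was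
not an inversion before, the new element stays in the class exactly when `p ∉ C`, a condition that
mentions neither `u` nor `v`. -/
theorem ascentCompatible_invClass (C D : Set (SignedSet n × SignedSet n)) :
    AscentCompatible (simpleB n) (invClass C D) := by
  rintro u hu v hv i j ⟨hi, hj, huv⟩
  rw [notMem_Des_iff] at hi hj
  obtain ⟨p, hp, hpu, ep, hup⟩ := hi.invSet_eq
  obtain ⟨q, hq, hqv, eq, huq⟩ := hj.invSet_eq
  obtain rfl : p = q := by
    rw [← huq p hp, ← huv, hup p hp]
  have key : ∀ {w : BGroup n}, w ∈ invClass C D → p ∉ invSet w →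
      (((insert p (invSet w) : Finset _) : Set (SignedSet n × SignedSet n)) ∩ C = D ↔ p ∉ C) := by
    intro w hw hpw
    rw [mem_invClass] at hw
    rw [Finset.coe_insert]
    constructor
    · intro h hpC
      have : p ∈ (invSet w : Set (SignedSet n × SignedSet n)) ∩ C := by
        rw [hw, ← h]
        exact ⟨Set.mem_insert _ _, hpC⟩
      exact hpw this.1
    · intro h
      rw [Set.insert_inter_of_notMem h, hw]
  rw [mem_invClass, mem_invClass, ep, eq, key hu hpu, key hv hqv]

/-- The pairs `(lowerB i, pos i)` are the simple roots, and `i` is a left descent of `w⁻¹` exactly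
when `w` inverts the `i`-th one. -/
theorem inv_descentClass_eq (I : Set (Fin n)) :
    (descentClass (simpleB n) I)⁻¹ =
      invClass (Set.range fun i => (lowerB i, pos i)) ((fun i => (lowerB i, pos i)) '' I) := by
  have hroot : ∀ i : Fin n, (lowerB i, pos i) ∈ posRoots n := fun i => by
    simp only [mem_posRoots, coe_lowerB, coe_pos]
    split_ifs <;> omega
  have hinj : Function.Injective fun i : Fin n => (lowerB i, pos i) := fun i j e => by
    have := congrArg (fun p : SignedSet n × SignedSet n => (p.2 : ℤ)) e
    simp only [coe_pos] at this
    omega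
  ext w
  have hmem : ∀ i, i ∈ Des (simpleB n) w⁻¹ ↔ (lowerB i, pos i) ∈ invSet w := fun i => by
    have hne : w.1 (lowerB i) ≠ w.1 (pos i) := fun e => by
      have := lowerB_lt i
      rw [w.1.injective e] at this
      exact lt_irrefl _ this
    rw [Ne, Subtype.ext_iff] at hne
    rw [mem_Des_iff, IsAsc, inv_inv, mem_invSet]
    simp only [hroot, true_and]
    omega
  rw [Set.mem_inv, descentClass, Set.mem_ofPred_eq, mem_invClass]
  have : (invSet w : Set (SignedSet n × SignedSet n)) ∩ (Set.range fun i => (lowerB i, pos i)) =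
      (fun i => (lowerB i, pos i)) '' Des (simpleB n) w⁻¹ := by
    ext p
    constructor
    · rintro ⟨hp, i, rfl⟩
      exact ⟨i, (hmem i).2 hp, rfl⟩
    · rintro ⟨i, hi, rfl⟩
      exact ⟨(hmem i).1 hi, i, rfl⟩
  rw [this, hinj.image_injective.eq_iff]

/-- Membership requires all inversions of `x` and none outside those of `y`; roots inverted by `y`
but not by `x` are left free. -/
theorem leftInterval_eq_invClass {x y : BGroup n} (h : LeftWeakLE (simpleB n) x y) :
    leftInterval (simpleB n) x y =
      invClass ((invSet x : Set (SignedSet n × SignedSet n)) ∪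
        (invSet y : Set (SignedSet n × SignedSet n))ᶜ) (invSet x) := by
  rw [leftWeakLE_iff] at h
  ext z
  rw [leftInterval, Set.mem_ofPred_eq, leftWeakLE_iff, leftWeakLE_iff, mem_invClass, Set.ext_iff]
  simp only [Set.mem_inter_iff, Finset.mem_coe, Set.mem_union, Set.mem_compl_iff]
  constructor
  · rintro ⟨h1, h2⟩ p
    exact ⟨fun hp => hp.2.resolve_right fun hy => hy (h2 hp.1), fun hp => ⟨h1 hp, Or.inl hp⟩⟩
  · intro h3
    refine ⟨fun p hp => ((h3 p).2 hp).1, fun p hp => ?_⟩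
    by_contra hy
    exact hy (h ((h3 p).1 ⟨hp, Or.inr hy⟩))

end InvClass

/-! ### The classes of unimodal elements as intervals -/

section Unimodal

variable {n : ℕ}

/-- The element of `B_n` given by an odd involution of the integers that preserves `±[n]`. -/
def BGroup.ofInvolution (f : ℤ → ℤ)
    (hf : ∀ x ∈ (Finset.Icc (-(n : ℤ)) n).erase 0, f x ∈ (Finset.Icc (-(n : ℤ)) n).erase 0)
    (hff : ∀ x ∈ (Finset.Icc (-(n : ℤ)) n).erase 0, f (f x) = x)
    (hneg : ∀ x ∈ (Finset.Icc (-(n : ℤ)) n).erase 0, f (-x) = -f x) : BGroup n :=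
  ⟨Function.Involutive.toPerm (fun x : SignedSet n => ⟨f x, hf x x.2⟩)
    fun x => Subtype.ext (hff x x.2), fun x => Subtype.ext (hneg x x.2)⟩

theorem BGroup.coe_ofInvolution_apply (f : ℤ → ℤ) (hf hff hneg) (x : SignedSet n) :
    (((BGroup.ofInvolution f hf hff hneg).1 x : SignedSet n) : ℤ) = f x := rfl

/-- Reversal of `1, …, i + 1`. -/
def unimodalMin (i : Fin n) : BGroup n :=
  BGroup.ofInvolution
    (fun x => if 0 < x ∧ x ≤ i + 1 then i + 2 - x
      else if x < 0 ∧ -((i : ℤ) + 1) ≤ x then -(i + 2) - x else x)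
    (fun x hx => by
      have := i.2
      simp only [Finset.mem_erase, Finset.mem_Icc] at hx ⊢
      split_ifs <;> omega)
    (fun x hx => by
      simp only [Finset.mem_erase, Finset.mem_Icc] at hx
      split_ifs <;> omega)
    (fun x hx => by
      simp only [Finset.mem_erase, Finset.mem_Icc] at hx
      split_ifs <;> omega)

/-- Negation of `1, …, i`, and negation and reversal of `i + 1, …, n`. -/
def unimodalMax (i : Fin n) : BGroup n :=
  BGroup.ofInvolution
    (fun x => if (i : ℤ) < x then x - (i + 1) - n
      else if x < -(i : ℤ) then x + (i + 1) + n else -x)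
    (fun x hx => by
      have := i.2
      simp only [Finset.mem_erase, Finset.mem_Icc] at hx ⊢
      split_ifs <;> omega)
    (fun x hx => by
      have := i.2
      simp only [Finset.mem_erase, Finset.mem_Icc] at hx
      split_ifs <;> omega)
    (fun x hx => by
      simp only [Finset.mem_erase, Finset.mem_Icc] at hx
      split_ifs <;> omega)

theorem mem_invSet_unimodalMin {i : Fin n} {p : SignedSet n × SignedSet n} :
    p ∈ invSet (unimodalMin i) ↔ (0 : ℤ) < p.1 ∧ (p.1 : ℤ) < p.2 ∧ (p.2 : ℤ) ≤ i + 1 := by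
  have h1 := p.1.bounds
  have h2 := p.2.bounds
  simp only [mem_invSet, mem_posRoots, unimodalMin, BGroup.coe_ofInvolution_apply]
  split_ifs <;> omega

/-- The only roots not inverted are the pairs of positive entries both at least `i + 1`, the ones on
which unimodality demands increase. -/
theorem mem_invSet_unimodalMax {i : Fin n} {p : SignedSet n × SignedSet n} :
    p ∈ invSet (unimodalMax i) ↔ p ∈ posRoots n ∧ (p.1 : ℤ) < i + 1 := by
  have h1 := p.1.bounds
  have h2 := p.2.bounds
  have := i.2
  simp only [mem_invSet, mem_posRoots, unimodalMax, BGroup.coe_ofInvolution_apply]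
  split_ifs <;> omega

theorem unimodalMin_le_unimodalMax (i : Fin n) :
    LeftWeakLE (simpleB n) (unimodalMin i) (unimodalMax i) := by
  rw [leftWeakLE_iff]
  intro p hp
  rw [mem_invSet_unimodalMin] at hp
  rw [mem_invSet_unimodalMax, mem_posRoots]
  omega

theorem SignedSet.exists_eq_pos {x : SignedSet n} (h : 0 < (x : ℤ)) : ∃ j : Fin n, x = pos j := by
  have hx := x.bounds
  refine ⟨⟨((x : ℤ) - 1).toNat, by omega⟩, ?_⟩
  rw [Subtype.ext_iff, coe_pos]
  simp only
  omega

theorem mk_pos_mem_posRoots {j k : Fin n} (h : j < k) : (pos j, pos k) ∈ posRoots n := by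
  simp only [mem_posRoots, coe_pos]
  have : (j : ℕ) < k := h
  omega

/-- The two halves of unimodality match the two bounds separately: decrease up to `i` says that
every inversion of `unimodalMin i` occurs, and increase from `i` on says that no root outside
`unimodalMax i` is inverted. -/
theorem inv_leftUnimodalClass_eq (i : Fin n) :
    (leftUnimodalClass n i)⁻¹ = leftInterval (simpleB n) (unimodalMin i) (unimodalMax i) := by
  ext w
  rw [Set.mem_inv, leftUnimodalClass, Set.mem_ofPred_eq, inv_inv, leftInterval, Set.mem_ofPred_eq,
    leftWeakLE_iff, leftWeakLE_iff]
  refine and_congr ⟨fun h p hp => ?_, fun h j hj k hk hjk => ?_⟩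
    ⟨fun h p hp => ?_, fun h j hj k hk hjk => ?_⟩
  · obtain ⟨a, b⟩ := p
    obtain ⟨h1, h2, h3⟩ := mem_invSet_unimodalMin.1 hp
    simp only at h1 h2 h3
    obtain ⟨j, rfl⟩ := SignedSet.exists_eq_pos h1
    obtain ⟨k, rfl⟩ := SignedSet.exists_eq_pos (h1.trans h2)
    rw [coe_pos, coe_pos] at h2
    rw [coe_pos] at h3
    have hjk : j < k := by
      rw [Fin.lt_def]
      omega
    have hki : k ≤ i := by
      rw [Fin.le_def]
      omega
    exact mem_invSet.2 ⟨mk_pos_mem_posRoots hjk, h (hjk.le.trans hki) hki hjk⟩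
  · refine (mem_invSet.1 (h (mem_invSet_unimodalMin (p := (pos j, pos k)).2 ?_))).2
    have h1 : (k : ℕ) ≤ i := hk
    have h2 : (j : ℕ) < k := hjk
    simp only [coe_pos]
    omega
  · rw [mem_invSet_unimodalMax]
    obtain ⟨h1, h2⟩ := mem_invSet.1 hp
    refine ⟨h1, ?_⟩
    by_contra hlt
    obtain ⟨a, b⟩ := p
    simp only [mem_posRoots] at h1 hlt h2
    obtain ⟨j, rfl⟩ := SignedSet.exists_eq_pos (x := a) (by omega)
    obtain ⟨k, rfl⟩ := SignedSet.exists_eq_pos (x := b) (by omega)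
    simp only [coe_pos] at h1 hlt
    have hjk : j < k := by
      rw [Fin.lt_def]
      omega
    have hij : i ≤ j := by
      rw [Fin.le_def]
      omega
    exact absurd (h hij (hij.trans hjk.le) hjk) (not_lt.2 h2.le)
  · have hne : w.1 (pos j) ≠ w.1 (pos k) := fun e => by
      have := congrArg Subtype.val (w.1.injective e)
      simp only [coe_pos] at this
      have h2 : (j : ℕ) < k := hjk
      omega
    rw [Ne, Subtype.ext_iff] at hne
    by_contra hlt
    simp only at hlt
    have := (mem_invSet_unimodalMax.1 (h (mem_invSet (p := (pos j, pos k)).2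
      ⟨mk_pos_mem_posRoots hjk, by simp only; omega⟩))).2
    simp only [coe_pos] at this
    have h1 : (i : ℕ) ≤ j := hj
    omega

end Unimodal

/-! ### Sorting operators and braid relations -/

section Sorting

variable {n : ℕ}

/-- `sortAt (i + 1)` puts the entries at `i` and `i + 1` into decreasing order, and `sortAt 0` makes
the entry at `0` nonpositive. -/
def sortAt : ℕ → (ℕ → ℤ) → ℕ → ℤ
  | 0, v => fun k => if k = 0 then min (v 0) (-v 0) else v k
  | i + 1, v => fun k =>
      if k = i then max (v i) (v (i + 1)) else if k = i + 1 then min (v i) (v (i + 1)) else v k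

theorem sortAt_sortAt (i : ℕ) (v : ℕ → ℤ) : sortAt i (sortAt i v) = sortAt i v := by
  cases i with
  | zero =>
    funext k
    simp only [sortAt, if_true]
    split_ifs <;> omega
  | succ i =>
    funext k
    simp only [sortAt]
    split_ifs <;> omega

theorem sortAt_comm {i j : ℕ} (h : i + 2 ≤ j) (v : ℕ → ℤ) :
    sortAt i (sortAt j v) = sortAt j (sortAt i v) := by
  obtain ⟨j, rfl⟩ : ∃ j', j = j' + 1 := ⟨j - 1, by omega⟩
  cases i with
  | zero =>
    funext k
    simp only [sortAt]
    split_ifs <;> first | contradiction | omega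
  | succ i =>
    funext k
    simp only [sortAt]
    split_ifs <;> omega

/-- Both sides put the three entries from `i` to `i + 2` into decreasing order. -/
theorem sortAt_braid (i : ℕ) (v : ℕ → ℤ) :
    sortAt (i + 1) (sortAt (i + 2) (sortAt (i + 1) v)) =
      sortAt (i + 2) (sortAt (i + 1) (sortAt (i + 2) v)) := by
  funext k
  have h1 : i + 1 + 1 ≠ i := by omega
  have h2 : i + 1 + 1 ≠ i + 1 := by omega
  have h3 : i + 1 ≠ i := by omega
  have h4 : i ≠ i + 1 := by omega
  have h5 : i ≠ i + 1 + 1 := by omega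
  have h6 : i + 1 ≠ i + 1 + 1 := by omega
  simp only [sortAt, h1, h2, h3, h4, h5, h6, if_true, if_false]
  split_ifs <;> omega

/-- Both sides replace the first two entries `a`, `b` by `-min(|a|, |b|)`, `-max(|a|, |b|)`. -/
theorem sortAt_braid_zero (v : ℕ → ℤ) :
    sortAt 0 (sortAt 1 (sortAt 0 (sortAt 1 v))) = sortAt 1 (sortAt 0 (sortAt 1 (sortAt 0 v))) := by
  funext k
  simp only [sortAt, if_true, if_false, one_ne_zero, zero_add, zero_ne_one]
  split_ifs
  · generalize v 0 = a
    generalize v 1 = b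
    omega
  · generalize v 0 = a
    generalize v 1 = b
    omega
  · rfl

/-- The one-line notation of `w⁻¹`, shifted by one and extended by zero. -/
def invOneLine (w : BGroup n) : ℕ → ℤ := fun j =>
  if h : j < n then ((w⁻¹).1 (pos ⟨j, h⟩) : ℤ) else 0

theorem invOneLine_injective : Function.Injective (invOneLine (n := n)) := by
  intro u w h
  have hpos : ∀ j : Fin n, (u⁻¹).1 (pos j) = (w⁻¹).1 (pos j) := fun j => by
    have := congrFun h j
    simp only [invOneLine, j.2, dif_pos] at this
    exact Subtype.ext this
  rw [← inv_inj]
  refine Subtype.ext (Equiv.ext fun x => ?_)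
  have hx := x.bounds
  rcases lt_or_gt_of_ne hx.1 with hneg | hpos'
  · obtain ⟨j, hj⟩ := SignedSet.exists_eq_pos (x := -x) (by rw [SignedSet.coe_neg]; omega)
    rw [← neg_neg x, hj, BGroup.map_neg, BGroup.map_neg, hpos]
  · obtain ⟨j, rfl⟩ := SignedSet.exists_eq_pos hpos'
    exact hpos j

open Classical in
/-- The operator `w ↦ max (w, s_i w)`. -/
noncomputable def demazure (i : Fin n) (w : BGroup n) : BGroup n :=
  if IsAsc w i then simpleB n i * w else w

/-- Left multiplication of `w` by `s_i` acts on the positions of `w⁻¹`, and an ascent is a pair of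
entries in increasing order (for `i = 0`, a positive first entry). Going up at ascents is therefore
sorting. -/
theorem invOneLine_demazure (i : Fin n) (w : BGroup n) :
    invOneLine (demazure i w) = sortAt i (invOneLine w) := by
  funext k
  have hpos : ∀ (j : ℕ) (hj : j < n) (hj' : j = (i : ℕ)), pos ⟨j, hj⟩ = pos i := by
    rintro j hj rfl
    rfl
  have hfix : ∀ (j : ℕ) (hj : j < n), j ≠ i → j + 1 ≠ i →
      (simpleB n i).1 (pos ⟨j, hj⟩) = pos ⟨j, hj⟩ := by
    intro j hj h1 h2
    rw [Subtype.ext_iff, coe_simpleB_apply, coe_pos]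
    simp only
    split_ifs <;> omega
  by_cases hi : (i : ℕ) = 0
  · have hlow : lowerB i = -pos i := by
      rw [Subtype.ext_iff, coe_lowerB, SignedSet.coe_neg, coe_pos]
      simp [hi]
    have hasc : IsAsc w i ↔ 0 < (((w⁻¹).1 (pos i) : SignedSet n) : ℤ) := by
      rw [IsAsc, hlow, BGroup.map_neg, SignedSet.coe_neg]
      omega
    have h0 : (simpleB n i).1 (pos i) = -pos i := hlow
    rw [hi]
    by_cases hk : k = 0
    · have hk0 : 0 < n := by omega
      simp only [sortAt, hk, if_true, invOneLine, hk0, dif_pos, hpos 0 hk0 hi.symm, demazure]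
      split_ifs with h
      · rw [inv_simpleB_mul_apply, h0, BGroup.map_neg, SignedSet.coe_neg,
          min_eq_right (by have := hasc.1 h; omega)]
      · rw [hasc, not_lt] at h
        rw [min_eq_left (by omega)]
    · simp only [sortAt, hk, if_false, invOneLine]
      split_ifs with hkn
      · rw [demazure]
        split_ifs with h
        · rw [inv_simpleB_mul_apply, hfix k hkn (by omega) (by omega)]
        · rfl
      · rfl
  · obtain ⟨m, hm⟩ : ∃ m, (i : ℕ) = m + 1 := ⟨i - 1, by omega⟩
    have hin := i.2
    have hmn : m < n := by omega
    have hmn' : m + 1 < n := by omega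
    have hlow : lowerB i = pos ⟨m, hmn⟩ := by
      rw [Subtype.ext_iff, coe_lowerB, coe_pos, if_neg hi, hm]
      simp
    have h1 : (simpleB n i).1 (pos i) = pos ⟨m, hmn⟩ := hlow
    have h2 : (simpleB n i).1 (pos ⟨m, hmn⟩) = pos i := by rw [← hlow, simpleB_lowerB]
    have hasc : IsAsc w i ↔ (((w⁻¹).1 (pos ⟨m, hmn⟩) : SignedSet n) : ℤ) < (w⁻¹).1 (pos i) := by
      rw [IsAsc, hlow]
    rw [hm]
    have hmne : m + 1 ≠ m := by omega
    by_cases hk : k = m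
    · subst hk
      simp only [sortAt, if_true, invOneLine, hmn, hmn', dif_pos, hpos _ hmn' hm.symm, demazure]
      split_ifs with h
      · rw [inv_simpleB_mul_apply, h2, max_eq_right (hasc.1 h).le]
      · rw [hasc, not_lt] at h
        rw [max_eq_left h]
    · by_cases hk' : k = m + 1
      · subst hk'
        simp only [sortAt, if_true, hmne, if_false, invOneLine, hmn, hmn', dif_pos,
          hpos _ hmn' hm.symm, demazure]
        split_ifs with h
        · rw [inv_simpleB_mul_apply, h1, min_eq_left (hasc.1 h).le]
        · rw [hasc, not_lt] at h
          rw [min_eq_right h]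
      · simp only [sortAt, hk, hk', if_false, invOneLine]
        split_ifs with hkn
        · rw [demazure]
          split_ifs with h
          · rw [inv_simpleB_mul_apply, hfix k hkn (by omega) (by omega)]
          · rfl
        · rfl

theorem demazure_demazure (i : Fin n) (w : BGroup n) :
    demazure i (demazure i w) = demazure i w :=
  invOneLine_injective (by simp only [invOneLine_demazure, sortAt_sortAt])

theorem demazure_comm {i j : Fin n} (h : (i : ℕ) + 2 ≤ j) (w : BGroup n) :
    demazure i (demazure j w) = demazure j (demazure i w) :=
  invOneLine_injective (by simp only [invOneLine_demazure, sortAt_comm h])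

theorem demazure_braid {i j : Fin n} (hi : 1 ≤ (i : ℕ)) (h : (j : ℕ) = i + 1) (w : BGroup n) :
    demazure i (demazure j (demazure i w)) = demazure j (demazure i (demazure j w)) := by
  obtain ⟨m, hm⟩ : ∃ m, (i : ℕ) = m + 1 := ⟨i - 1, by omega⟩
  exact invOneLine_injective (by simp only [invOneLine_demazure, h, hm, sortAt_braid])

theorem demazure_braid_zero {i j : Fin n} (hi : (i : ℕ) = 0) (hj : (j : ℕ) = 1) (w : BGroup n) :
    demazure i (demazure j (demazure i (demazure j w))) =
      demazure j (demazure i (demazure j (demazure i w))) :=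
  invOneLine_injective (by simp only [invOneLine_demazure, hi, hj, sortAt_braid_zero])

theorem invSet_subset_demazure (i : Fin n) (w : BGroup n) : invSet w ⊆ invSet (demazure i w) := by
  rw [demazure]
  split_ifs with h
  · exact h.invSet_subset
  · exact subset_rfl

end Sorting

/-! ### Modules over the 0-Hecke algebra -/

section HeckeModules

variable {n : ℕ}

/-- Induction over the algebra generated by the `π_i`. -/
theorem heckeB_induction {P : HeckeB n → Prop} (hC : ∀ c, P (algebraMap ℂ (HeckeB n) c))
    (hpi : ∀ i, P (heckePi n i)) (hadd : ∀ a b, P a → P b → P (a + b))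
    (hmul : ∀ a b, P a → P b → P (a * b)) (h : HeckeB n) : P h := by
  obtain ⟨x, rfl⟩ := RingQuot.mkAlgHom_surjective ℂ (HeckeBRel n) h
  induction x using FreeAlgebra.induction with
  | grade0 c => simpa using hC c
  | grade1 i => exact hpi i
  | mul a b ha hb => simpa using hmul _ _ ha hb
  | add a b ha hb => simpa using hadd _ _ ha hb

variable {M N : Type*} [AddCommGroup M] [Module ℂ M] [Module (HeckeB n) M]
  [IsScalarTower ℂ (HeckeB n) M] [AddCommGroup N] [Module ℂ N] [Module (HeckeB n) N]
  [IsScalarTower ℂ (HeckeB n) N]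

/-- A linear map that commutes with the `π_i` is a homomorphism of modules. -/
def heckeLinearMap (f : M →ₗ[ℂ] N) (hf : ∀ i v, f (heckePi n i • v) = heckePi n i • f v) :
    M →ₗ[HeckeB n] N where
  toFun := f
  map_add' := f.map_add
  map_smul' := fun h => by
    refine heckeB_induction (P := fun h => ∀ v, f (h • v) = h • f v) ?_ hf ?_ ?_ h
    · intro c v
      rw [algebraMap_smul, algebraMap_smul, map_smul]
    · intro a b ha hb v
      rw [add_smul, add_smul, map_add, ha, hb]
    · intro a b ha hb v
      rw [mul_smul, mul_smul, ha, hb]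

/-- A subspace that is stable under the `π_i` is a submodule. -/
def heckeSubmodule (p : Submodule ℂ M) (hp : ∀ i, ∀ v ∈ p, heckePi n i • v ∈ p) :
    Submodule (HeckeB n) M where
  carrier := p
  add_mem' := p.add_mem
  zero_mem' := p.zero_mem
  smul_mem' := fun h v hv => by
    refine heckeB_induction (P := fun h => ∀ v ∈ p, h • v ∈ p) ?_ hp ?_ ?_ h v hv
    · intro c v hv
      rw [algebraMap_smul]
      exact p.smul_mem c hv
    · intro a b ha hb v hv
      rw [add_smul]
      exact p.add_mem (ha v hv) (hb v hv)
    · intro a b ha hb v hv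
      rw [mul_smul]
      exact ha _ (hb v hv)

/-- Operators that satisfy the defining relations give a module structure. -/
theorem exists_heckeModule (M : Type*) [AddCommGroup M] [Module ℂ M] (T : Fin n → Module.End ℂ M)
    (hsq : ∀ i, T i * T i = -T i)
    (hcomm : ∀ i j : Fin n, (i : ℕ) + 2 ≤ j → T i * T j = T j * T i)
    (hbraid : ∀ i j : Fin n, 1 ≤ (i : ℕ) → (j : ℕ) = i + 1 → T i * T j * T i = T j * T i * T j)
    (hzero : ∀ i j : Fin n, (i : ℕ) = 0 → (j : ℕ) = 1 →
      T i * T j * T i * T j = T j * T i * T j * T i) :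
    ∃ (_ : Module (HeckeB n) M) (_ : IsScalarTower ℂ (HeckeB n) M),
      ∀ (i : Fin n) (v : M), heckePi n i • v = T i v := by
  let φ : HeckeB n →ₐ[ℂ] Module.End ℂ M :=
    RingQuot.liftAlgHom ℂ ⟨FreeAlgebra.lift ℂ T, by
      intro x y h
      induction h with
      | sq i => simpa using hsq i
      | comm i j h => simpa using hcomm i j h
      | braid i j hi h => simpa using hbraid i j hi h
      | braid_zero i j hi hj => simpa using hzero i j hi hj⟩
  let _ : Module (HeckeB n) M := Module.compHom M φ.toRingHom
  have hdef : ∀ (h : HeckeB n) (v : M), h • v = φ h v := fun _ _ => rfl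
  refine ⟨inferInstance, ⟨fun c h v => ?_⟩, fun i v => ?_⟩
  · rw [hdef, hdef, map_smul, LinearMap.smul_apply]
  · rw [hdef]
    simp [φ, heckePi, RingQuot.liftAlgHom_mkAlgHom_apply]

end HeckeModules

/-! ### Classes in the Grothendieck group -/

section Grothendieck

variable {n : ℕ}

theorem grothendieckClass_of_exact {A B C : Type}
    [AddCommGroup A] [Module ℂ A] [Module (HeckeB n) A] [IsScalarTower ℂ (HeckeB n) A]
    [Module.Finite ℂ A]
    [AddCommGroup B] [Module ℂ B] [Module (HeckeB n) B] [IsScalarTower ℂ (HeckeB n) B]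
    [Module.Finite ℂ B]
    [AddCommGroup C] [Module ℂ C] [Module (HeckeB n) C] [IsScalarTower ℂ (HeckeB n) C]
    [Module.Finite ℂ C]
    (f : A →ₗ[HeckeB n] B) (g : B →ₗ[HeckeB n] C) (hf : Function.Injective f)
    (hfg : Function.Exact f g) (hg : Function.Surjective g) :
    grothendieckClass n B = grothendieckClass n A + grothendieckClass n C := by
  have h : (QuotientAddGroup.mk (FreeAbelianGroup.of (HeckeMod.mk A) -
      FreeAbelianGroup.of (HeckeMod.mk B) + FreeAbelianGroup.of (HeckeMod.mk C)) :
      GrothendieckB n) = 0 := by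
    rw [QuotientAddGroup.eq_zero_iff]
    exact AddSubgroup.subset_closure ⟨HeckeMod.mk A, HeckeMod.mk B, HeckeMod.mk C, f, g, hf, hfg,
      hg, rfl⟩
  rw [QuotientAddGroup.mk_add, QuotientAddGroup.mk_sub] at h
  change grothendieckClass n A - grothendieckClass n B + grothendieckClass n C = 0 at h
  rw [← sub_eq_zero, ← neg_eq_zero, ← h]
  abel

theorem chB_of_exact {A B C : Type}
    [AddCommGroup A] [Module ℂ A] [Module (HeckeB n) A] [IsScalarTower ℂ (HeckeB n) A]
    [Module.Finite ℂ A]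
    [AddCommGroup B] [Module ℂ B] [Module (HeckeB n) B] [IsScalarTower ℂ (HeckeB n) B]
    [Module.Finite ℂ B]
    [AddCommGroup C] [Module ℂ C] [Module (HeckeB n) C] [IsScalarTower ℂ (HeckeB n) C]
    [Module.Finite ℂ C]
    (f : A →ₗ[HeckeB n] B) (g : B →ₗ[HeckeB n] C) (hf : Function.Injective f)
    (hfg : Function.Exact f g) (hg : Function.Surjective g) :
    chB n B = chB n A + chB n C := by
  rw [chB, grothendieckClass_of_exact f g hf hfg hg, map_add]
  rfl

variable {M : Type} [AddCommGroup M] [Module ℂ M] [Module (HeckeB n) M]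
  [IsScalarTower ℂ (HeckeB n) M] [Module.Finite ℂ M]

/-- For a zero module `M → M → M` with identity maps is short exact, so the characteristic equals
its own double. -/
theorem chB_of_subsingleton [Subsingleton M] : chB n M = 0 := by
  have := chB_of_exact (n := n) (LinearMap.id : M →ₗ[HeckeB n] M)
    (LinearMap.id : M →ₗ[HeckeB n] M) Function.injective_id
    (fun x => ⟨fun _ => ⟨x, rfl⟩, fun _ => Subsingleton.elim _ _⟩) Function.surjective_id
  exact left_eq_add.1 this

instance heckeSubmodule_finite (p : Submodule (HeckeB n) M) : Module.Finite ℂ p :=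
  inferInstanceAs (Module.Finite ℂ (p.restrictScalars ℂ))

theorem chB_bot : chB n (⊥ : Submodule (HeckeB n) M) = 0 := chB_of_subsingleton

theorem chB_top : chB n (⊤ : Submodule (HeckeB n) M) = chB n M := by
  have := chB_of_exact (n := n) (A := (⊤ : Submodule (HeckeB n) M)) (B := M)
    (C := (⊥ : Submodule (HeckeB n) M)) (Submodule.subtype _) 0 (Submodule.injective_subtype _)
    (fun x => ⟨fun _ => ⟨⟨x, trivial⟩, rfl⟩, fun _ => LinearMap.zero_apply x⟩)
    (fun x => ⟨0, Subsingleton.elim _ _⟩)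
  rw [this, chB_bot, add_zero]

/-- A homomorphism from a submodule `B` onto `Q` with kernel `A ≤ B` splits the characteristic. -/
theorem chB_submodule {A B : Submodule (HeckeB n) M} (hAB : A ≤ B) {Q : Type}
    [AddCommGroup Q] [Module ℂ Q] [Module (HeckeB n) Q] [IsScalarTower ℂ (HeckeB n) Q]
    [Module.Finite ℂ Q] (g : B →ₗ[HeckeB n] Q) (hg : Function.Surjective g)
    (hker : ∀ v : B, g v = 0 ↔ (v : M) ∈ A) :
    chB n B = chB n A + chB n Q := by
  refine chB_of_exact (Submodule.inclusion hAB) g (Submodule.inclusion_injective hAB) ?_ hg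
  intro v
  rw [hker]
  exact ⟨fun h => ⟨⟨v, h⟩, rfl⟩, by rintro ⟨u, rfl⟩; exact u.2⟩

/-- The characteristic of a finite direct sum. -/
theorem chB_directSum {κ : Type} [Fintype κ] [DecidableEq κ] (V : κ → Type)
    [∀ i, AddCommGroup (V i)] [∀ i, Module ℂ (V i)] [∀ i, Module (HeckeB n) (V i)]
    [∀ i, IsScalarTower ℂ (HeckeB n) (V i)] [∀ i, Module.Finite ℂ (V i)] :
    chB n (⨁ i, V i) = ∑ i, chB n (V i) := by
  -- Filtration by support: adjoining an index `a` to `T` adds the layer `V a`, through the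
  -- projection to that component.
  let F : Finset κ → Submodule (HeckeB n) (⨁ i, V i) := fun T =>
    { carrier := {v | ∀ i ∉ T, v i = 0}
      add_mem' := fun {a b} ha hb i hi => by rw [DirectSum.add_apply, ha i hi, hb i hi, add_zero]
      zero_mem' := fun i _ => rfl
      smul_mem' := fun h v hv i hi => by rw [DirectSum.smul_apply, hv i hi, smul_zero] }
  have hF : ∀ T (v : ⨁ i, V i), v ∈ F T ↔ ∀ i ∉ T, v i = 0 := fun _ _ => Iff.rfl
  have key : ∀ T, chB n (F T) = ∑ i ∈ T, chB n (V i) := by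
    intro T
    induction T using Finset.induction_on with
    | empty =>
      have : F ∅ = ⊥ := by
        rw [eq_bot_iff]
        intro v hv
        rw [Submodule.mem_bot]
        exact DFinsupp.ext fun i => hv i (Finset.notMem_empty i)
      rw [this, chB_bot, Finset.sum_empty]
    | insert a T ha ih =>
      rw [Finset.sum_insert ha, ← ih, add_comm]
      refine chB_submodule (A := F T) (B := F (insert a T))
        (fun v hv i hi => hv i fun h => hi (Finset.mem_insert_of_mem h))
        ((DirectSum.component (HeckeB n) κ V a).comp (F (insert a T)).subtype) ?_ ?_
      · intro x
        refine ⟨⟨DirectSum.lof (HeckeB n) κ V a x, fun i hi => ?_⟩, ?_⟩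
        · rw [Finset.mem_insert, not_or] at hi
          exact DFinsupp.single_eq_of_ne hi.1
        · exact DirectSum.component.lof_self (HeckeB n) (M := V) a x
      · intro v
        rw [hF]
        constructor
        · intro h i hi
          by_cases e : i = a
          · subst e
            exact h
          · exact v.2 i (by simp [e, hi])
        · intro h
          exact h a ha
  have htop : F Finset.univ = ⊤ := by
    rw [eq_top_iff]
    intro v _ i hi
    exact absurd (Finset.mem_univ i) hi
  rw [← chB_top, ← htop, key]

end Grothendieck

/-! ### The modules `ℂX` and their characteristics -/

section WeakOrderModules

variable {n : ℕ}

open Classical in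
theorem piOp_single (X : Set (BGroup n)) (i : Fin n) (x : X) :
    piOp (simpleB n) X i (Finsupp.single x 1) =
      if IsAsc (x : BGroup n) i then
        if h : simpleB n i * (x : BGroup n) ∈ X then
          Finsupp.single ⟨simpleB n i * (x : BGroup n), h⟩ 1 else 0
      else -Finsupp.single x 1 := by
  rw [piOp, Finsupp.linearCombination_single, one_smul]
  by_cases h : IsAsc (x : BGroup n) i
  · rw [if_neg (notMem_Des_iff.2 h), if_pos h]
  · rw [if_pos (mem_Des_iff.2 h), if_neg h]

open Classical in
/-- The basis vector of `y` with the sign of `y`, or zero if `y ∉ X`. -/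
noncomputable def signedVec (X : Set (BGroup n)) (y : BGroup n) : X →₀ ℂ :=
  if h : y ∈ X then (-1 : ℂ) ^ (invSet y).card • Finsupp.single ⟨y, h⟩ 1 else 0

theorem signedVec_ext {X : Set (BGroup n)} {f g : (X →₀ ℂ) →ₗ[ℂ] (X →₀ ℂ)}
    (h : ∀ x ∈ X, f (signedVec X x) = g (signedVec X x)) : f = g := by
  refine Finsupp.lhom_ext' fun x => LinearMap.ext_ring ?_
  have := h x x.2
  simp only [signedVec, x.2, dif_pos, map_smul] at this
  exact smul_right_injective _ (pow_ne_zero _ (neg_ne_zero.2 one_ne_zero)) this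

/-- On signed basis vectors, `-π_i` is the operator `demazure i`. -/
theorem piOp_signedVec {C D : Set (SignedSet n × SignedSet n)} {y : BGroup n}
    (hy : D ⊆ (invSet y : Set (SignedSet n × SignedSet n)) ∩ C) (i : Fin n) :
    piOp (simpleB n) (invClass C D) i (signedVec (invClass C D) y) =
      -signedVec (invClass C D) (demazure i y) := by
  by_cases hX : y ∈ invClass C D
  · rw [signedVec, dif_pos hX, map_smul, piOp_single]
    by_cases h : IsAsc y i
    · rw [demazure, if_pos h, if_pos h, signedVec]
      split_ifs with hX'
      · rw [h.card_invSet, pow_succ, mul_neg_one, neg_smul, neg_neg]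
      · simp
    · rw [demazure, if_neg h, if_neg h, signedVec, dif_pos hX, smul_neg]
  · have hX' : demazure i y ∉ invClass C D := by
      intro h
      rw [mem_invClass] at h
      refine hX (Set.Subset.antisymm ?_ hy)
      rw [← h]
      exact Set.inter_subset_inter_left _ (Finset.coe_subset.2 (invSet_subset_demazure i y))
    rw [signedVec, signedVec, dif_neg hX, dif_neg hX', map_zero, neg_zero]

theorem subset_invSet_demazure {C D : Set (SignedSet n × SignedSet n)} {y : BGroup n}
    (hy : D ⊆ (invSet y : Set (SignedSet n × SignedSet n)) ∩ C) (i : Fin n) :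
    D ⊆ (invSet (demazure i y) : Set (SignedSet n × SignedSet n)) ∩ C :=
  hy.trans (Set.inter_subset_inter_left _ (Finset.coe_subset.2 (invSet_subset_demazure i y)))

/-- On signed basis vectors both sides of each relation become, up to a common sign, a single signed
vector indexed by an iterated Demazure operator. The hypothesis of `piOp_signedVec` is carried
through three applications, as the longest relation composes four operators. -/
theorem exists_module_invClass (C D : Set (SignedSet n × SignedSet n)) :
    ∃ (_ : Module (HeckeB n) (invClass C D →₀ ℂ))
      (_ : IsScalarTower ℂ (HeckeB n) (invClass C D →₀ ℂ)),
      ∀ (i : Fin n) (v : invClass C D →₀ ℂ),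
        heckePi n i • v = piOp (simpleB n) (invClass C D) i v := by
  have hsub : ∀ x ∈ invClass C D,
      D ⊆ (invSet x : Set (SignedSet n × SignedSet n)) ∩ C := fun x hx => (mem_invClass.1 hx).ge
  refine exists_heckeModule _ _ (fun i => ?_) (fun i j h => ?_) (fun i j hi h => ?_)
    fun i j hi hj => ?_ <;> refine signedVec_ext fun x hx => ?_ <;>
    have h1 := subset_invSet_demazure (hsub x hx) <;>
    have h2 := fun i => subset_invSet_demazure (h1 i) <;>
    have h3 := fun i j => subset_invSet_demazure (h2 i j) <;>
    simp only [Module.End.mul_apply, LinearMap.neg_apply, map_neg, piOp_signedVec, hsub x hx, h1,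
      h2, h3, neg_neg]
  · rw [demazure_demazure]
  · rw [demazure_comm h]
  · rw [demazure_braid hi h]
  · rw [demazure_braid_zero hi hj]

/-- The subspace of `ℂX` spanned by a set that is closed under ascents is stable. -/
theorem piOp_mem_supported {X : Set (BGroup n)} {T : Set X}
    (hT : ∀ x ∈ T, ∀ i, IsAsc (x : BGroup n) i → ∀ h : simpleB n i * (x : BGroup n) ∈ X,
      (⟨simpleB n i * (x : BGroup n), h⟩ : X) ∈ T)
    (i : Fin n) {v : X →₀ ℂ} (hv : v ∈ Finsupp.supported ℂ ℂ T) :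
    piOp (simpleB n) X i v ∈ Finsupp.supported ℂ ℂ T := by
  have : Finsupp.supported ℂ ℂ T ≤
      (Finsupp.supported ℂ ℂ T).comap (piOp (simpleB n) X i) := by
    conv_lhs => rw [Finsupp.supported_eq_span_single]
    rw [Submodule.span_le]
    rintro _ ⟨x, hx, rfl⟩
    simp only [SetLike.mem_coe, Submodule.mem_comap, piOp_single]
    split_ifs with h h'
    · exact Finsupp.single_mem_supported ℂ _ (hT x hx i h h')
    · exact Submodule.zero_mem _
    · exact Submodule.neg_mem _ (Finsupp.single_mem_supported ℂ _ hx)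
  exact this hv

open Classical in
/-- The coordinate at an element of minimum length is an eigenvector of the dual of `π_i`. -/
theorem piOp_apply_of_minimal {X : Set (BGroup n)} {T : Set X} {x : X}
    (hmin : ∀ y ∈ T, (invSet (x : BGroup n)).card ≤ (invSet (y : BGroup n)).card)
    (i : Fin n) {v : X →₀ ℂ} (hv : v ∈ Finsupp.supported ℂ ℂ T) :
    piOp (simpleB n) X i v x =
      (if i ∈ Des (simpleB n) (x : BGroup n) then (-1 : ℂ) else 0) * v x := by
  -- Both sides are linear in `v`, so basis vectors of `T` suffice. An ascent from `y ∈ T` cannot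
  -- land on `x`, since it is longer than `y` and `x` has minimum length.
  rw [Finsupp.supported_eq_span_single] at hv
  refine LinearMap.eqOn_span (f := (Finsupp.lapply x).comp (piOp (simpleB n) X i))
    (g := (if i ∈ Des (simpleB n) (x : BGroup n) then (-1 : ℂ) else 0) •
      (Finsupp.lapply x : (X →₀ ℂ) →ₗ[ℂ] ℂ)) ?_ hv
  rintro _ ⟨y, hy, rfl⟩
  simp only [LinearMap.comp_apply, LinearMap.smul_apply, Finsupp.lapply_apply, piOp_single,
    smul_eq_mul]
  have hne : ∀ (h : IsAsc (y : BGroup n) i) (h' : simpleB n i * (y : BGroup n) ∈ X),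
      x ≠ ⟨simpleB n i * (y : BGroup n), h'⟩ := by
    rintro h h' rfl
    have h1 := hmin y hy
    have h2 := h.card_invSet
    simp only at h1
    omega
  by_cases e : x = y
  · subst e
    by_cases h : IsAsc (x : BGroup n) i
    · rw [if_pos h, if_neg (notMem_Des_iff.2 h), zero_mul]
      split_ifs with h'
      · exact Finsupp.single_eq_of_ne (hne h h')
      · rfl
    · rw [if_neg h, if_pos (mem_Des_iff.2 h)]
      simp
  · rw [Finsupp.single_eq_of_ne e, mul_zero]
    split_ifs with h h'
    · exact Finsupp.single_eq_of_ne (hne h h')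
    · rfl
    · rw [Finsupp.neg_apply, Finsupp.single_eq_of_ne e, neg_zero]

/-- Subsets of `X` closed under ascents within `X` span submodules, and these form a filtration with
one-dimensional layers. Only the formula for the action is used, so `X` is arbitrary once the module
structure exists. -/
theorem chB_weakOrderModule (X : Set (BGroup n)) [Module (HeckeB n) (X →₀ ℂ)]
    [IsScalarTower ℂ (HeckeB n) (X →₀ ℂ)]
    (hpi : ∀ (i : Fin n) (v : X →₀ ℂ), heckePi n i • v = piOp (simpleB n) X i v) :
    chB n (X →₀ ℂ) = ∑ᶠ x ∈ X, fundB n (Des (simpleB n) x) := by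
  classical
  have : Fintype X := Fintype.ofFinite X
  let F : ∀ T : Finset X, (∀ x ∈ T, ∀ i, IsAsc (x : BGroup n) i →
      ∀ h : simpleB n i * (x : BGroup n) ∈ X, (⟨simpleB n i * (x : BGroup n), h⟩ : X) ∈ T) →
      Submodule (HeckeB n) (X →₀ ℂ) := fun T hT =>
    heckeSubmodule (Finsupp.supported ℂ ℂ (T : Set X)) fun i v hv => by
      rw [hpi]
      exact piOp_mem_supported (T := (T : Set X)) hT i hv
  have hF : ∀ T hT (v : X →₀ ℂ), v ∈ F T hT ↔ v ∈ Finsupp.supported ℂ ℂ (T : Set X) :=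
    fun _ _ _ => Iff.rfl
  have key : ∀ k, ∀ (T : Finset X) (hT), T.card = k →
      chB n (F T hT) = ∑ x ∈ T, fundB n (Des (simpleB n) (x : BGroup n)) := by
    intro k
    induction k with
    | zero =>
      intro T hT hk
      obtain rfl := Finset.card_eq_zero.1 hk
      have : F ∅ hT = ⊥ := by
        rw [eq_bot_iff]
        intro v hv
        rw [hF _ hT, Finset.coe_empty, Finsupp.supported_empty] at hv
        exact hv
      rw [this, chB_bot, Finset.sum_empty]
    | succ k ih =>
      intro T hT hk
      obtain ⟨x, hx, hmin⟩ := Finset.exists_min_image T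
        (fun x => (invSet (x : BGroup n)).card) (Finset.card_pos.1 (by omega))
      -- Ascents raise length, so none leads to the shortest element `x`, and removing it preserves
      -- closure.
      have hT' : ∀ y ∈ T.erase x, ∀ i, IsAsc (y : BGroup n) i →
          ∀ h : simpleB n i * (y : BGroup n) ∈ X,
            (⟨simpleB n i * (y : BGroup n), h⟩ : X) ∈ T.erase x := by
        intro y hy i hi h
        rw [Finset.mem_erase] at hy ⊢
        refine ⟨fun e => ?_, hT y hy.2 i hi h⟩
        have h1 := hmin y hy.2
        have h2 := hi.card_invSet
        rw [← e] at h1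
        simp only at h1
        omega
      have hle : F (T.erase x) hT' ≤ F T hT := fun v hv =>
        Finsupp.supported_mono (M := ℂ) (R := ℂ) (Finset.coe_subset.2 (Finset.erase_subset x T)) hv
      -- The coordinate at `x` realizes the quotient by the smaller submodule as the simple module
      -- of `Des x`.
      let f : F T hT →ₗ[ℂ] SimpleMod n (Des (simpleB n) (x : BGroup n)) :=
        { toFun := fun v => (v : X →₀ ℂ) x
          map_add' := fun _ _ => rfl
          map_smul' := fun _ _ => rfl }
      have hf : ∀ i v, f (heckePi n i • v) = heckePi n i • f v := fun i v => by
        rw [SimpleMod.smul_def, heckeChar_pi]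
        change (heckePi n i • (v : X →₀ ℂ)) x = _
        rw [hpi]
        exact piOp_apply_of_minimal (T := (T : Set X)) hmin i v.2
      let g : F T hT →ₗ[HeckeB n] SimpleMod n (Des (simpleB n) (x : BGroup n)) :=
        heckeLinearMap (n := n) (M := F T hT)
          (N := SimpleMod n (Des (simpleB n) (x : BGroup n))) f hf
      have hg : ∀ v : F T hT, g v = (v : X →₀ ℂ) x := fun _ => rfl
      rw [← Finset.sum_erase_add T _ hx, ← ih (T.erase x) hT' (by
        rw [Finset.card_erase_of_mem hx, hk, Nat.add_sub_cancel]),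
        ← chHom_simple]
      refine chB_submodule hle g (fun c => ?_) fun v => ?_
      · exact ⟨⟨Finsupp.single x c, Finsupp.single_mem_supported ℂ _ hx⟩,
          Finsupp.single_eq_same⟩
      · rw [hg, hF _ hT', Finsupp.mem_supported']
        have hv := (Finsupp.mem_supported' ℂ _).1 v.2
        constructor
        · intro h y hy
          by_cases e : y = x
          · exact e ▸ h
          · exact hv y (by simpa [e] using hy)
        · intro h
          exact h x (by simp)
  have htop : F Finset.univ (fun _ _ _ _ _ => Finset.mem_univ _) = ⊤ := by
    rw [eq_top_iff]
    intro v _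
    rw [hF _ fun _ _ _ _ _ => Finset.mem_univ _, Finset.coe_univ, Finsupp.supported_univ]
    trivial
  rw [← chB_top, ← htop, key _ _ (fun _ _ _ _ _ => Finset.mem_univ _) rfl, ← finsum_eq_sum_of_fintype,
    finsum_set_coe_eq_finsum_mem (f := fun x => fundB n (Des (simpleB n) x))]

theorem QB_eq (X : Set (BGroup n)) : QB n X = ∑ᶠ x ∈ X⁻¹, fundB n (Des (simpleB n) x) := by
  refine finsum_mem_eq_of_bijOn (·⁻¹) ?_ fun _ _ => rfl
  exact ⟨fun x hx => by simpa using hx, inv_injective.injOn, fun x hx => ⟨x⁻¹, hx, inv_inv x⟩⟩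

/-- A set whose inverse has prescribed inversions affords a module with the expected
characteristic. -/
theorem exists_module_of_inv_eq_invClass {X : Set (BGroup n)}
    {C D : Set (SignedSet n × SignedSet n)} (hX : X⁻¹ = invClass C D) :
    ∃ (_ : Module (HeckeB n) (↥X⁻¹ →₀ ℂ)) (_ : IsScalarTower ℂ (HeckeB n) (↥X⁻¹ →₀ ℂ)),
      (∀ (j : Fin n) (v : ↥X⁻¹ →₀ ℂ), heckePi n j • v = piOp (simpleB n) X⁻¹ j v) ∧
      chB n (↥X⁻¹ →₀ ℂ) = QB n X := by
  rw [QB_eq, hX]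
  obtain ⟨i1, i2, h⟩ := exists_module_invClass C D
  exact ⟨i1, i2, h, chB_weakOrderModule _ h⟩

theorem QB_leftUnimodal : QB n (leftUnimodal n) = ∑ i, QB n (leftUnimodalClass n i) := by
  have hdisj : ∀ i j : Fin n, i < j →
      Disjoint (leftUnimodalClass n i) (leftUnimodalClass n j) := by
    intro i j hij
    rw [Set.disjoint_left]
    rintro σ ⟨-, h1⟩ ⟨h2, -⟩
    -- Between `i` and `j` the first class demands increase and the second decrease.
    exact lt_asymm (h1 Set.self_mem_Ici hij.le hij) (h2 hij.le Set.self_mem_Iic hij)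
  rw [QB, leftUnimodal, finsum_mem_iUnion, finsum_eq_sum_of_fintype]
  · rfl
  · intro i j hij
    rcases lt_or_gt_of_ne hij with h | h
    · exact hdisj i j h
    · exact (hdisj j i h).symm
  · exact fun i => Set.toFinite _

end WeakOrderModules

theorem mainTheorem12 (n : ℕ) :
    -- inverses of left descent classes and of the classes `L_i^B` are ascent-compatible
    (∀ I : Set (Fin n), AscentCompatible (simpleB n) (descentClass (simpleB n) I)⁻¹) ∧
    (∀ i : Fin n, AscentCompatible (simpleB n) (leftUnimodalClass n i)⁻¹) ∧
    -- the latter are explicit intervals in the left weak order (positions are shifted by one)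
    (∀ i : Fin n, ∃ τ σ : BGroup n,
      (∀ j : Fin n, (τ.1 (pos j) : ℤ) =
        if j ≤ i then ((i : ℤ) + 1) + 1 - ((j : ℤ) + 1) else (j : ℤ) + 1) ∧
      (∀ j : Fin n, (σ.1 (pos j) : ℤ) =
        if j < i then -((j : ℤ) + 1) else ((j : ℤ) + 1) - ((i : ℤ) + 1) - (n : ℤ)) ∧
      LeftWeakLE (simpleB n) τ σ ∧
      (leftUnimodalClass n i)⁻¹ = leftInterval (simpleB n) τ σ) ∧
    -- the modules of the descent classes and their characteristics
    (∀ I : Set (Fin n),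
      ∃ (_ : Module (HeckeB n) (↥(descentClass (simpleB n) I)⁻¹ →₀ ℂ))
        (_ : IsScalarTower ℂ (HeckeB n) (↥(descentClass (simpleB n) I)⁻¹ →₀ ℂ)),
        (∀ (j : Fin n) (v : ↥(descentClass (simpleB n) I)⁻¹ →₀ ℂ),
          heckePi n j • v = piOp (simpleB n) (descentClass (simpleB n) I)⁻¹ j v) ∧
        chB n (↥(descentClass (simpleB n) I)⁻¹ →₀ ℂ) = QB n (descentClass (simpleB n) I)) ∧
    -- the modules of the classes `L_i^B`, their characteristics, and that of their direct sum
    (∃ (_ : ∀ i : Fin n, Module (HeckeB n) (↥(leftUnimodalClass n i)⁻¹ →₀ ℂ))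
       (_ : ∀ i : Fin n, IsScalarTower ℂ (HeckeB n) (↥(leftUnimodalClass n i)⁻¹ →₀ ℂ)),
       (∀ (i j : Fin n) (v : ↥(leftUnimodalClass n i)⁻¹ →₀ ℂ),
          heckePi n j • v = piOp (simpleB n) (leftUnimodalClass n i)⁻¹ j v) ∧
       (∀ i : Fin n, chB n (↥(leftUnimodalClass n i)⁻¹ →₀ ℂ) = QB n (leftUnimodalClass n i)) ∧
       chB n (⨁ i : Fin n, (↥(leftUnimodalClass n i)⁻¹ →₀ ℂ)) = QB n (leftUnimodal n)) := by
  have hL : ∀ i : Fin n, (leftUnimodalClass n i)⁻¹ = _ := fun i =>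
    (inv_leftUnimodalClass_eq i).trans
      (leftInterval_eq_invClass (unimodalMin_le_unimodalMax i))
  refine ⟨fun I => ?_, fun i => ?_, fun i => ?_, fun I => ?_, ?_⟩
  · rw [inv_descentClass_eq]
    exact ascentCompatible_invClass _ _
  · rw [hL]
    exact ascentCompatible_invClass _ _
  · refine ⟨unimodalMin i, unimodalMax i, fun j => ?_, fun j => ?_,
      unimodalMin_le_unimodalMax i, inv_leftUnimodalClass_eq i⟩
    · simp only [unimodalMin, BGroup.coe_ofInvolution_apply, coe_pos, Fin.le_def]
      split_ifs <;> omega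
    · simp only [unimodalMax, BGroup.coe_ofInvolution_apply, coe_pos, Fin.lt_def]
      split_ifs <;> omega
  · exact exists_module_of_inv_eq_invClass (inv_descentClass_eq I)
  · choose i1 i2 hpi hch using fun i : Fin n => exists_module_of_inv_eq_invClass (hL i)
    refine ⟨i1, i2, hpi, hch, ?_⟩
    rw [QB_leftUnimodal, chB_directSum]
    exact Finset.sum_congr rfl fun i _ => hch i
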